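/- Let $\mathbb D$ be the open unit disc and $\mathbb T$ the unit circle. For $b\in H^\infty$ with $\|b\|_{H^\infty}\le 1$, let $\mathcal H(b)$ be the de Branges–Rovnyak space, that is, the reproducing kernel Hilbert space on $\mathbb D$ with kernel $$k^b_\lambda(z)=\frac{1-b(z)\overline{b(\lambda)}}{1-z\overline\lambda},\qquad z,\lambda\in\mathbb D.$$ For a finite positive Borel measure $\mu$ on $\mathbb T$, let $\mathcal D_\mu$ be the harmonically weighted Dirichlet space, that is, the set of all $f\in H^2$ with $$\frac1\pi\int_{\mathbb D}|f'(z)|^2P_\mu(z)\,dA(z)<\infty,\qquad P_\mu(z)=\int_{\mathbb T}\frac{1-|z|^2}{|z-\zeta|^2}\,d\mu(\zeta).$$ For $E\subset\mathbb T$ put $$c_{b,1}(E)=\inf\{\|f\|^2_{\mathcal H(b)} : f\in\mathcal H(b),\ |f|\ge 1 \text{ a.e. on a neighbourhood of } E\},$$ $$c_{b,2}(E)=\inf\{\|f\|^2_{\mathcal H(b)} : f\in\mathcal H(b),\ |f|=1 \text{ a.e. on a neighbourhood of } E\},$$ where a neighbourhood of $E$ is taken in $\mathbb T$, the values of $f$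 on $\mathbb T$ are its radial limits, and "a.e." refers to arc length. **Proposition.** Let $b\in H^\infty$ with $\|b\|_{H^\infty}=1$ and let $\mu$ be a finite positive Borel measure on $\mathbb T$. If $\mathcal H(b)=\mathcal D_\mu$ as sets of functions, then there exists a constant $A>0$ such that $$c_{b,2}(E)\le A\,c_{b,1}(E)\qquad\text{for every } E\subset\mathbb T.$$ -/

import Mathlib

open Metric MeasureTheory Set Filter Topology
open scoped ComplexConjugate ENNReal NNReal Complex.UnitDisc

/-! ### Holomorphic functions on the open unit disc `𝔻` -/

/-- A function on the disc, extended by `0` to the plane, so that derivatives and radial limits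
can be written down. -/
noncomputable def discExt (f : 𝔻 → ℂ) : ℂ → ℂ :=
  Function.extend (fun z : 𝔻 => (z : ℂ)) f 0

theorem discExt_coe (f : 𝔻 → ℂ) (z : 𝔻) : discExt f (z : ℂ) = f z :=
  Complex.UnitDisc.coe_injective.extend_apply f 0 z

/-- `f` is holomorphic on the open unit disc. -/
def HolomorphicOnDisc (f : 𝔻 → ℂ) : Prop :=
  DifferentiableOn ℂ (discExt f) (ball 0 1)

/-- The closed unit ball of `H^∞`: holomorphic functions on the disc bounded by `1`. -/
def HInftyBall : Type :=
  {b : 𝔻 → ℂ // HolomorphicOnDisc b ∧ ∀ z, ‖b z‖ ≤ 1}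

/-- The `H^∞` norm `sup_{z ∈ 𝔻} |b(z)|`; the supremum is over a nonempty set bounded by `1`. -/
noncomputable def HInftyBall.norm (b : HInftyBall) : ℝ :=
  ⨆ z : 𝔻, ‖b.1 z‖

/-- Membership in the Hardy space `H²`: holomorphic with
`sup_{0 < r < 1} (1 / 2π) ∫_0^{2π} |f(r e^{iθ})|² dθ < ∞`. -/
def MemHardyTwo (f : 𝔻 → ℂ) : Prop :=
  HolomorphicOnDisc f ∧
    ⨆ r ∈ Ioo (0 : ℝ) 1, ENNReal.ofReal (1 / (2 * Real.pi)) *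
      ∫⁻ θ in Ioc (0 : ℝ) (2 * Real.pi), ‖discExt f (r * (Circle.exp θ : ℂ))‖ₑ ^ 2 < ∞

/-! ### Harmonically weighted Dirichlet spaces -/

/-- The unit circle carries its Borel `σ`-algebra. -/
noncomputable instance Circle.instMeasurableSpaceBorel : MeasurableSpace Circle := borel Circle

instance Circle.instBorelSpaceBorel : BorelSpace Circle := ⟨rfl⟩

/-- The Poisson integral `P_μ(z) = ∫_𝕋 (1 - |z|²) / |z - ζ|² dμ(ζ)`, used for `|z| < 1`. -/
noncomputable def poissonIntegral (μ : Measure Circle) (z : ℂ) : ℝ≥0∞ :=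
  ∫⁻ ζ : Circle, ENNReal.ofReal ((1 - ‖z‖ ^ 2) / ‖z - (ζ : ℂ)‖ ^ 2) ∂μ

/-- The weighted Dirichlet integral `(1 / π) ∫_𝔻 |f'(z)|² P_μ(z) dA(z)`. -/
noncomputable def dirichletIntegral (μ : Measure Circle) (f : 𝔻 → ℂ) : ℝ≥0∞ :=
  ENNReal.ofReal (1 / Real.pi) *
    ∫⁻ z in ball (0 : ℂ) 1, ‖deriv (discExt f) z‖ₑ ^ 2 * poissonIntegral μ z

/-- The harmonically weighted Dirichlet space `D_μ`, as a set of functions on the disc. -/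
def weightedDirichletSpace (μ : Measure Circle) : Set (𝔻 → ℂ) :=
  {f | MemHardyTwo f ∧ dirichletIntegral μ f < ∞}

/-! ### De Branges–Rovnyak spaces -/

/-- The kernel `k^b_λ(z) = (1 - b(z) conj (b λ)) / (1 - z conj λ)`; row index `z`,
column index `λ`, and a complex number is regarded as a multiplication operator on `ℂ`. -/
noncomputable def deBrangesRovnyakKernel (b : HInftyBall) : Matrix 𝔻 𝔻 (ℂ →L[ℂ] ℂ) :=
  Matrix.of fun z w =>
    ((1 - b.1 z * conj (b.1 w)) / (1 - (z : ℂ) * conj (w : ℂ))) • ContinuousLinearMap.id ℂ ℂ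

/-- Auxiliary positivity statement, for symbols continuous up to the circle. -/
theorem schurKernel_nonneg_of_diffContOnCl {β : ℂ → ℂ} (hβ : DiffContOnCl ℂ β (ball 0 1))
    (hβ1 : ∀ z ∈ sphere (0 : ℂ) 1, ‖β z‖ ≤ 1) (s : Finset 𝔻) (c : 𝔻 → ℂ) :
    0 ≤ (∑ x ∈ s, ∑ y ∈ s, conj (c x) * c y *
      ((1 - β x * conj (β y)) / (1 - (x : ℂ) * conj (y : ℂ)))).re := by
  have hden : ∀ (y : 𝔻) (ζ : ℂ), ‖ζ‖ ≤ 1 → 1 - ζ * conj (y : ℂ) ≠ 0 := by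
    intro y ζ hζ h
    have h1 : ‖ζ * conj (y : ℂ)‖ < 1 := by
      rw [norm_mul, RCLike.norm_conj]
      exact (mul_le_of_le_one_left (norm_nonneg _) hζ).trans_lt y.norm_lt_one
    rw [sub_eq_zero] at h
    rw [← h, norm_one] at h1
    exact lt_irrefl _ h1
  have hker : ∀ d : 𝔻 → ℂ,
      DiffContOnCl ℂ (fun ζ : ℂ => ∑ y ∈ s, d y / (1 - ζ * conj (y : ℂ))) (ball 0 1) := by
    intro d
    apply DifferentiableOn.diffContOnCl
    rw [closure_ball (0 : ℂ) one_ne_zero]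
    refine DifferentiableOn.fun_sum fun y _ => ?_
    refine DifferentiableOn.div (by fun_prop) (by fun_prop) fun ζ hζ => hden y ζ (by simpa using hζ)
  set F : ℂ → ℂ := fun ζ => ∑ y ∈ s, c y / (1 - ζ * conj (y : ℂ)) with hF
  set G : ℂ → ℂ := fun ζ => ∑ y ∈ s, (c y * conj (β y)) / (1 - ζ * conj (y : ℂ)) with hG
  have hFd : DiffContOnCl ℂ F (ball 0 1) := hker _
  have hGd : DiffContOnCl ℂ G (ball 0 1) := hker _
  let h : 𝔻 → ℂ → ℂ := fun x ζ =>
    conj (c x) * (F ζ - β ζ * G ζ - β ζ * G ζ + β x * G ζ)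
  have hβG : DiffContOnCl ℂ (fun ζ => β ζ * G ζ) (ball 0 1) := by
    simpa only [smul_eq_mul] using hβ.smul hGd
  have hh : ∀ x, DiffContOnCl ℂ (h x) (ball 0 1) := fun x =>
    (((hFd.sub hβG).sub hβG).add (hGd.const_smul (β x))).const_smul (conj (c x))
  let P : 𝔻 → ℂ → ℂ := fun x ζ => ((ζ - 0) / (ζ - x)) • h x ζ
  have hP : ∀ x, Real.circleAverage (P x) 0 1 = h x x := fun x =>
    DiffContOnCl.circleAverage_smul_div (c := 0) (R := 1) (by simpa using hh x)
      (by simpa using x.norm_lt_one)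
  have hsub : ∀ (x : 𝔻) (ζ : ℂ), ‖ζ‖ = 1 → ζ - x ≠ 0 := by
    intro x ζ hζ h0
    rw [sub_eq_zero] at h0
    exact (x.norm_ne_one) (h0 ▸ hζ)
  have hPi : ∀ x, CircleIntegrable (P x) 0 1 := by
    intro x
    apply ContinuousOn.circleIntegrable zero_le_one
    refine ContinuousOn.smul (ContinuousOn.div (by fun_prop) (by fun_prop) fun ζ hζ =>
      hsub x ζ (by simpa using hζ)) ?_
    refine ((hh x).continuousOn).mono ?_
    rw [closure_ball (0 : ℂ) one_ne_zero]
    exact sphere_subset_closedBall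
  have hsum : Real.circleAverage (fun ζ => ∑ x ∈ s, P x ζ) 0 1 = ∑ x ∈ s, h x x := by
    rw [Real.circleAverage_fun_sum fun x _ => hPi x]
    exact Finset.sum_congr rfl fun x _ => hP x
  have hre : (Real.circleAverage (fun ζ => ∑ x ∈ s, P x ζ) 0 1).re
      = Real.circleAverage (fun ζ => (∑ x ∈ s, P x ζ).re) 0 1 := by
    have hci : CircleIntegrable (fun ζ => ∑ x ∈ s, P x ζ) 0 1 := by
      have h0 := CircleIntegrable.sum s (fun x _ => hPi x)
      have h1 : (∑ x ∈ s, P x) = fun ζ => ∑ x ∈ s, P x ζ := by ext ζ; simp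
      rwa [h1] at h0
    exact (Complex.reCLM.circleAverage_comp_comm hci).symm
  have hfinal : ∑ x ∈ s, ∑ y ∈ s, conj (c x) * c y *
      ((1 - β x * conj (β y)) / (1 - (x : ℂ) * conj (y : ℂ))) = ∑ x ∈ s, h x x := by
    refine Finset.sum_congr rfl fun x _ => ?_
    simp only [h, hF, hG]
    rw [sub_add_cancel, Finset.mul_sum, ← Finset.sum_sub_distrib, Finset.mul_sum]
    refine Finset.sum_congr rfl fun y _ => ?_
    ring
  rw [hfinal, ← hsum, hre]
  refine Real.circleAverage_nonneg_of_nonneg fun ζ hζ => ?_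
  have hζ1 : ‖ζ‖ = 1 := by simpa using hζ
  have hζ0 : ζ ≠ 0 := by intro h0; simp [h0] at hζ1
  have hconj : conj ζ = ζ⁻¹ := (Complex.inv_eq_conj hζ1).symm
  have hk : ∀ x : 𝔻, (ζ - 0) / (ζ - x) = conj (1 / (1 - ζ * conj (x : ℂ))) := by
    intro x
    have := hsub x ζ hζ1
    simp only [map_div₀, map_one, map_sub, map_mul, Complex.conj_conj, hconj, sub_zero]
    rw [show (1 : ℂ) - ζ⁻¹ * x = (ζ - x) / ζ by field_simp, one_div_div]
  have hFc : conj (F ζ) = ∑ x ∈ s, ((ζ - 0) / (ζ - x)) * conj (c x) := by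
    simp only [hF, map_sum]
    refine Finset.sum_congr rfl fun x _ => ?_
    rw [hk, ← map_mul]; congr 1; ring
  have hGc : conj (G ζ) = ∑ x ∈ s, ((ζ - 0) / (ζ - x)) * (conj (c x) * β x) := by
    simp only [hG, map_sum]
    refine Finset.sum_congr rfl fun x _ => ?_
    rw [hk]; simp; ring
  have hval : ∑ x ∈ s, P x ζ
      = conj (F ζ) * (F ζ - β ζ * G ζ - β ζ * G ζ) + conj (G ζ) * G ζ := by
    rw [hFc, hGc, Finset.sum_mul, Finset.sum_mul, ← Finset.sum_add_distrib]
    refine Finset.sum_congr rfl fun x _ => ?_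
    simp only [P, h, smul_eq_mul]
    ring
  rw [hval]
  have hβζ : ‖β ζ‖ ≤ 1 := hβ1 ζ (by simpa using hζ)
  have h1 : (conj (F ζ) * (F ζ - β ζ * G ζ - β ζ * G ζ) + conj (G ζ) * G ζ).re
      = ‖F ζ‖ ^ 2 - 2 * (conj (F ζ) * (β ζ * G ζ)).re + ‖G ζ‖ ^ 2 := by
    rw [← Complex.normSq_eq_norm_sq, ← Complex.normSq_eq_norm_sq]
    simp [Complex.normSq_apply]
    ring
  rw [h1]
  have h2 : (conj (F ζ) * (β ζ * G ζ)).re ≤ ‖F ζ‖ * ‖G ζ‖ := by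
    refine (Complex.re_le_norm _).trans ?_
    rw [norm_mul, norm_mul, RCLike.norm_conj]
    exact mul_le_mul_of_nonneg_left (mul_le_of_le_one_left (norm_nonneg _) hβζ) (norm_nonneg _)
  nlinarith [sq_nonneg (‖F ζ‖ - ‖G ζ‖)]

theorem schurKernel_nonneg (b : HInftyBall) (s : Finset 𝔻) (c : 𝔻 → ℂ) :
    0 ≤ (∑ x ∈ s, ∑ y ∈ s, conj (c x) * c y *
      ((1 - b.1 x * conj (b.1 y)) / (1 - (x : ℂ) * conj (y : ℂ)))).re := by
  obtain ⟨b, hb, hb1⟩ := b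
  have hcont : ∀ x : 𝔻, Tendsto (fun r : ℝ => discExt b (r * (x : ℂ))) (𝓝[<] 1) (𝓝 (b x)) := by
    intro x
    have hx : (x : ℂ) ∈ ball (0 : ℂ) 1 := by simpa using x.norm_lt_one
    have h1 : ContinuousAt (discExt b) (x : ℂ) :=
      (hb.differentiableAt (isOpen_ball.mem_nhds hx)).continuousAt
    have h2 : Tendsto (fun r : ℝ => (r : ℂ) * (x : ℂ)) (𝓝[<] 1) (𝓝 (x : ℂ)) := by
      have : Continuous fun r : ℝ => (r : ℂ) * (x : ℂ) := by fun_prop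
      exact (this.tendsto' 1 _ (by simp)).mono_left nhdsWithin_le_nhds
    have h3 := h1.tendsto.comp h2
    rwa [discExt_coe] at h3
  have hlim : Tendsto (fun r : ℝ => (∑ x ∈ s, ∑ y ∈ s, conj (c x) * c y *
      ((1 - discExt b (r * (x : ℂ)) * conj (discExt b (r * (y : ℂ)))) /
        (1 - (x : ℂ) * conj (y : ℂ)))).re) (𝓝[<] 1)
      (𝓝 (∑ x ∈ s, ∑ y ∈ s, conj (c x) * c y *
        ((1 - b x * conj (b y)) / (1 - (x : ℂ) * conj (y : ℂ)))).re) := by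
    refine (Complex.continuous_re.tendsto _).comp ?_
    refine tendsto_finsetSum _ fun x _ => tendsto_finsetSum _ fun y _ => ?_
    refine Tendsto.const_mul _ (Tendsto.div_const (Tendsto.const_sub _ ((hcont x).mul ?_)) _)
    exact (Complex.continuous_conj.tendsto _).comp (hcont y)
  refine ge_of_tendsto hlim ?_
  have hev : ∀ᶠ r : ℝ in 𝓝[<] 1, r ∈ Ioo (0 : ℝ) 1 := Ioo_mem_nhdsLT zero_lt_one
  filter_upwards [hev] with r hr
  have hmaps : ∀ z : ℂ, ‖z‖ ≤ 1 → ‖(r : ℂ) * z‖ < 1 := by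
    intro z hz
    rw [norm_mul, Complex.norm_of_nonneg hr.1.le]
    nlinarith [hr.1, hr.2, norm_nonneg z]
  refine schurKernel_nonneg_of_diffContOnCl (β := fun z => discExt b (r * z)) ?_ ?_ s c
  · apply DifferentiableOn.diffContOnCl
    rw [closure_ball (0 : ℂ) one_ne_zero]
    refine DifferentiableOn.comp hb (by fun_prop) fun z hz => ?_
    simpa using hmaps z (by simpa using hz)
  · intro z hz
    have h1 := hmaps z (by simpa using (mem_sphere_zero_iff_norm.1 hz).le)
    have h2 := discExt_coe b (Complex.UnitDisc.mk _ h1)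
    rw [Complex.UnitDisc.coe_mk] at h2
    change ‖discExt b (r * z)‖ ≤ 1
    rw [h2]
    exact hb1 _

/-- The de Branges–Rovnyak kernel is positive semidefinite. -/
theorem deBrangesRovnyakKernel_posSemidef (b : HInftyBall) :
    (deBrangesRovnyakKernel b).PosSemidef := by
  have htfae := RKHS.posSemidef_tfae (K := deBrangesRovnyakKernel b)
  refine (htfae.out 0 2 :).2 ⟨?_, fun c => ?_⟩
  · ext z w
    have hid : star (ContinuousLinearMap.id ℂ ℂ) = ContinuousLinearMap.id ℂ ℂ := star_one _
    simp [deBrangesRovnyakKernel, Matrix.conjTranspose_apply, mul_comm, hid]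
  · have h := schurKernel_nonneg b c.support c
    rw [Finset.sum_comm] at h
    refine h.trans_eq ?_
    change _ = Complex.re _
    rw [← Complex.conj_re]
    congr 1
    simp only [Finsupp.sum, map_sum]
    refine Finset.sum_congr rfl fun x _ => Finset.sum_congr rfl fun y _ => ?_
    simp [deBrangesRovnyakKernel]
    ring

instance deBrangesRovnyakKernel_fact (b : HInftyBall) :
    Fact (deBrangesRovnyakKernel b).PosSemidef :=
  ⟨deBrangesRovnyakKernel_posSemidef b⟩

/-- The de Branges–Rovnyak space `H(b)`: the reproducing kernel Hilbert space on the disc with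
kernel `k^b`. Its elements coerce to functions `𝔻 → ℂ`. -/
abbrev DeBrangesRovnyakSpace (b : HInftyBall) : Type :=
  RKHS.OfKernel (deBrangesRovnyakKernel b)

/-- `H(b)` as a set of functions on the disc. -/
def deBrangesRovnyakFunctions (b : HInftyBall) : Set (𝔻 → ℂ) :=
  range fun f : DeBrangesRovnyakSpace b => (f : 𝔻 → ℂ)

/-! ### The two capacities -/

/-- At almost every point of `U ⊆ 𝕋` (with respect to arc length) the radial limit of `f` exists
and satisfies `p`. -/
def AEBoundaryValueOn (f : 𝔻 → ℂ) (U : Set Circle) (p : ℂ → Prop) : Prop :=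
  ∀ᵐ θ : ℝ, Circle.exp θ ∈ U →
    ∃ w : ℂ, Tendsto (fun r : ℝ => discExt f (r * (Circle.exp θ : ℂ))) (𝓝[<] 1) (𝓝 w) ∧ p w

/-- `c_{b,1}(E) = inf {‖f‖² : f ∈ H(b), |f| ≥ 1 a.e. on a neighbourhood of E}`. -/
noncomputable def capacityOne (b : HInftyBall) (E : Set Circle) : ℝ≥0∞ :=
  ⨅ (f : DeBrangesRovnyakSpace b)
    (_ : ∃ U : Set Circle, IsOpen U ∧ E ⊆ U ∧ AEBoundaryValueOn (⇑f) U fun w => 1 ≤ ‖w‖),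
    ‖f‖ₑ ^ 2

/-- `c_{b,2}(E) = inf {‖f‖² : f ∈ H(b), |f| = 1 a.e. on a neighbourhood of E}`. -/
noncomputable def capacityTwo (b : HInftyBall) (E : Set Circle) : ℝ≥0∞ :=
  ⨅ (f : DeBrangesRovnyakSpace b)
    (_ : ∃ U : Set Circle, IsOpen U ∧ E ⊆ U ∧ AEBoundaryValueOn (⇑f) U fun w => ‖w‖ = 1),
    ‖f‖ₑ ^ 2

/-!
Since `H(b)` and `D_μ` are the same set of functions, the closed graph theorem and the open mapping
theorem make the norm of `H(b)` equivalent to that of `D_μ` (`exists_norm_equivalence`); in both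
cases point evaluations are continuous, so there is only one possible limit. It therefore suffices
to replace a function `f ∈ D_μ` with `|f| ≥ 1` a.e. on an open set `U` by some `g ∈ D_μ` with
`|g| = 1` a.e. on `U`, while controlling the norm of `D_μ`
(`exists_unimodular_on_of_one_le_norm`).

The function `g` is the outer function whose modulus on the circle is
`min ((|f|² + ε²) ^ (1/2), 1)`. The square of its `H²` norm exceeds that of `f` by at most `ε²`.
For the Dirichlet integral, let `P_w` be the harmonic measure of a point `w` of the disc and
consider the defect in Jensen's inequality, `P_w[X] - exp P_w[log X]`, for functions `X > 0` on the
circle. For `X = |g|²` it equals `P_w[|g|²] - |g w|²`, since `g` is outer. For `X = |f|² + ε²` it is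
at most `P_w[|f|²] - |f w|²`, because `log (|f|² + ε²)` is subharmonic
(`norm_sq_add_le_exp_integral_log`). And the truncation of `X` at height `1`, which leads from the
second function to the first, does not increase it (`integral_min_one_sub_exp_le`). On the other
hand, for `h` equal to `f` or `g`,
`P_w[|h|²] - |h w|²` is the square of the `H²` norm of `h ∘ φ_w - h w`, for `φ_w` the disc
automorphism exchanging `0` and `w`; comparing power series coefficients, it agrees up to a
constant factor with `∫ |(h ∘ φ_w)'|² (1 - |z|²) dA`, which a change of variables turns
into `∫ |h'|² (1 - |φ_w|²) dA`. So this local energy of `g` at `w` is at most a constant times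
that of `f` (`localEnergy_outerFunction_le`). Divided by `1 - |w|²`, the weight `1 - |φ_w|²` tends
to the Poisson kernel at `ζ` as `w → ζ` along the radius; integrating over `ζ` with respect to `μ`
gives the weighted Dirichlet integral.
-/

/-! ### Power series on the disc -/

/-- The `n`-th Taylor coefficient of `f` at the origin. -/
noncomputable def taylorCoeff (f : ℂ → ℂ) (n : ℕ) : ℂ :=
  (n.factorial : ℂ)⁻¹ * iteratedDeriv n f 0

theorem hasSum_taylorCoeff {f : ℂ → ℂ} (hf : DifferentiableOn ℂ f (ball 0 1)) {z : ℂ}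
    (hz : z ∈ ball (0 : ℂ) 1) : HasSum (fun n => taylorCoeff f n * z ^ n) (f z) := by
  have h := Complex.hasSum_taylorSeries_on_ball hf hz
  refine h.congr_fun fun n => ?_
  simp [taylorCoeff]
  ring

theorem taylorCoeff_zero (f : ℂ → ℂ) : taylorCoeff f 0 = f 0 := by
  simp [taylorCoeff]

theorem taylorCoeff_deriv (f : ℂ → ℂ) (n : ℕ) :
    taylorCoeff (deriv f) n = (n + 1) * taylorCoeff f (n + 1) := by
  have h : (n.factorial : ℂ) ≠ 0 := by exact_mod_cast n.factorial_ne_zero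
  have h' : (n + 1 : ℂ) ≠ 0 := by exact_mod_cast n.succ_ne_zero
  simp only [taylorCoeff, ← iteratedDeriv_succ', Nat.factorial_succ]
  push_cast
  field_simp

theorem summable_norm_taylorCoeff_mul_pow {f : ℂ → ℂ} (hf : DifferentiableOn ℂ f (ball 0 1))
    {r : ℝ} (hr0 : 0 ≤ r) (hr : r < 1) : Summable fun n => ‖taylorCoeff f n‖ * r ^ n := by
  have h : (r : ℂ) ∈ ball (0 : ℂ) 1 := by simpa [abs_of_nonneg hr0] using hr
  have := (hasSum_taylorCoeff hf h).summable.norm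
  simpa [abs_of_nonneg hr0] using this

theorem integral_circleMap_pow_mul_conj_pow (m n : ℕ) :
    ∫ θ in (0 : ℝ)..2 * Real.pi, circleMap 0 1 θ ^ m * conj (circleMap 0 1 θ ^ n)
      = if m = n then (2 * Real.pi : ℂ) else 0 := by
  have h : ∀ θ : ℝ, circleMap 0 1 θ ^ m * conj (circleMap 0 1 θ ^ n)
      = Complex.exp ((((m : ℤ) - (n : ℤ) : ℤ) : ℂ) * Complex.I * θ) := by
    intro θ
    simp only [circleMap, Complex.ofReal_one, one_mul, zero_add, ← Complex.exp_nat_mul,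
      ← Complex.exp_conj, ← Complex.exp_add, map_mul, Complex.conj_I, Complex.conj_ofReal,
      map_natCast]
    congr 1
    push_cast
    ring
  simp_rw [h]
  split_ifs with hmn
  · simp [hmn]
  · have hne : ((((m : ℤ) - (n : ℤ) : ℤ) : ℂ)) ≠ 0 := by
      exact_mod_cast sub_ne_zero.2 (by exact_mod_cast hmn : (m : ℤ) ≠ n)
    rw [integral_exp_mul_complex (mul_ne_zero hne Complex.I_ne_zero)]
    have : Complex.exp
        ((((m : ℤ) - (n : ℤ) : ℤ) : ℂ) * Complex.I * ((2 * Real.pi : ℝ) : ℂ)) = 1 := by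
      rw [← Complex.exp_int_mul_two_pi_mul_I ((m : ℤ) - (n : ℤ))]
      congr 1
      push_cast
      ring
    rw [this]
    simp

/-- Parseval's identity for an absolutely convergent power series on the unit circle. -/
theorem hasSum_sq_circleAverage {b : ℕ → ℂ} (hb : Summable fun n => ‖b n‖) {F : ℂ → ℂ}
    (hF : ∀ z ∈ sphere (0 : ℂ) 1, HasSum (fun n => b n * z ^ n) (F z)) :
    HasSum (fun n => ‖b n‖ ^ 2) (Real.circleAverage (fun z => ‖F z‖ ^ 2) 0 1) := by
  have hcm : ∀ θ : ℝ, ‖circleMap 0 1 θ‖ = 1 := fun θ => by simp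
  have hF' : ∀ θ : ℝ, HasSum (fun n => b n * circleMap 0 1 θ ^ n) (F (circleMap 0 1 θ)) :=
    fun θ => hF _ (by simp)
  have hcont : Continuous fun θ : ℝ => F (circleMap 0 1 θ) := by
    have : (fun θ : ℝ => F (circleMap 0 1 θ)) = fun θ => ∑' n, b n * circleMap 0 1 θ ^ n :=
      funext fun θ => (hF' θ).tsum_eq.symm
    rw [this]
    exact continuous_tsum (fun n => by fun_prop) hb fun n θ => by simp
  obtain ⟨C, hC⟩ : ∃ C, ∀ θ : ℝ, ‖F (circleMap 0 1 θ)‖ ≤ C :=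
    ⟨∑' n, ‖b n‖, fun θ => by
      rw [← (hF' θ).tsum_eq]
      have h2 : Summable fun n => ‖b n * circleMap 0 1 θ ^ n‖ := by simpa using hb
      simpa using norm_tsum_le_tsum_norm h2⟩
  have hI : ∀ n, ∫ θ in (0 : ℝ)..2 * Real.pi,
      F (circleMap 0 1 θ) * conj (circleMap 0 1 θ ^ n) = 2 * Real.pi * b n := by
    intro n
    have h1 := intervalIntegral.hasSum_integral_of_dominated_convergence
      (F := fun m θ => b m * circleMap 0 1 θ ^ m * conj (circleMap 0 1 θ ^ n))
      (f := fun θ => F (circleMap 0 1 θ) * conj (circleMap 0 1 θ ^ n))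
      (μ := volume) (a := 0) (b := 2 * Real.pi) (fun m _ => ‖b m‖)
      (fun m => (by fun_prop : Continuous _).aestronglyMeasurable)
      (fun m => by simp) (by simp [hb]) (by simp)
      (by simpa using Eventually.of_forall fun θ _ => (hF' θ).mul_right _)
    have h2 : ∀ m, ∫ θ in (0 : ℝ)..2 * Real.pi,
        b m * circleMap 0 1 θ ^ m * conj (circleMap 0 1 θ ^ n)
        = if m = n then 2 * Real.pi * b n else 0 := by
      intro m
      simp_rw [mul_assoc]
      rw [intervalIntegral.integral_const_mul, integral_circleMap_pow_mul_conj_pow]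
      split_ifs with h
      · rw [h]; ring
      · simp
    simp_rw [h2] at h1
    exact h1.unique (hasSum_ite_eq n _)
  have h3 := intervalIntegral.hasSum_integral_of_dominated_convergence
      (F := fun m θ => conj (F (circleMap 0 1 θ)) * (b m * circleMap 0 1 θ ^ m))
      (f := fun θ => conj (F (circleMap 0 1 θ)) * F (circleMap 0 1 θ))
      (μ := volume) (a := 0) (b := 2 * Real.pi) (fun m _ => C * ‖b m‖)
      (fun m => ((Complex.continuous_conj.comp hcont).mul
        (by fun_prop)).aestronglyMeasurable)
      (fun m => by
        refine Eventually.of_forall fun θ _ => ?_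
        simp only [norm_mul, RCLike.norm_conj, norm_pow, hcm, one_pow, mul_one]
        exact mul_le_mul_of_nonneg_right (hC θ) (norm_nonneg _))
      (by simp [hb.mul_left]) (by simp)
      (by simpa using Eventually.of_forall fun θ _ => (hF' θ).mul_left _)
  have h4 : ∀ m, ∫ θ in (0 : ℝ)..2 * Real.pi,
      conj (F (circleMap 0 1 θ)) * (b m * circleMap 0 1 θ ^ m)
      = ((2 * Real.pi * ‖b m‖ ^ 2 : ℝ) : ℂ) := by
    intro m
    have : ∀ θ : ℝ, conj (F (circleMap 0 1 θ)) * (b m * circleMap 0 1 θ ^ m)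
        = b m * conj (F (circleMap 0 1 θ) * conj (circleMap 0 1 θ ^ m)) := by
      intro θ
      simp
      ring
    simp_rw [this]
    rw [intervalIntegral.integral_const_mul, intervalIntegral.intervalIntegral_conj, hI]
    have := Complex.mul_conj' (b m)
    push_cast
    rw [← this]
    simp only [map_mul, map_ofNat, Complex.conj_ofReal]
    ring
  simp_rw [h4] at h3
  have h5 : (∫ θ in (0 : ℝ)..2 * Real.pi, conj (F (circleMap 0 1 θ)) * F (circleMap 0 1 θ))
      = ((∫ θ in (0 : ℝ)..2 * Real.pi, ‖F (circleMap 0 1 θ)‖ ^ 2 : ℝ) : ℂ) := by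
    rw [← intervalIntegral.integral_ofReal]
    congr 1
    ext θ
    rw [Complex.conj_mul']
    simp
  rw [h5] at h3
  have h6 := (Complex.hasSum_ofReal.1 h3).mul_left ((2 * Real.pi)⁻¹)
  rw [Real.circleAverage_def]
  refine h6.congr_fun fun n => ?_
  field_simp

/-- Parseval's identity on the circle of radius `r < 1`. -/
theorem hasSum_sq_taylorCoeff {f : ℂ → ℂ} (hf : DifferentiableOn ℂ f (ball 0 1))
    {r : ℝ} (hr0 : 0 ≤ r) (hr : r < 1) :
    HasSum (fun n => ‖taylorCoeff f n‖ ^ 2 * r ^ (2 * n))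
      (Real.circleAverage (fun z => ‖f z‖ ^ 2) 0 r) := by
  have h := hasSum_sq_circleAverage (b := fun n => taylorCoeff f n * (r : ℂ) ^ n)
    (F := fun z => f (r * z)) ?_ fun z hz => ?_
  · rw [Real.circleAverage_eq_circleAverage_zero_one]
    convert h using 1
    · ext n
      simp [mul_pow, abs_of_nonneg hr0, pow_mul']
    · simp
  · simpa [abs_of_nonneg hr0] using summable_norm_taylorCoeff_mul_pow hf hr0 hr
  · have hz1 : ‖z‖ = 1 := by simpa using hz
    have := hasSum_taylorCoeff hf (z := r * z) (by simp [hz1, abs_of_nonneg hr0, hr])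
    simpa [mul_pow, mul_assoc] using this

theorem continuous_comp_circleMap {f : ℂ → ℂ} (hf : DifferentiableOn ℂ f (ball 0 1))
    {r : ℝ} (hr0 : 0 ≤ r) (hr : r < 1) : Continuous fun θ : ℝ => f (circleMap 0 r θ) :=
  hf.continuousOn.comp_continuous (by fun_prop) fun θ => by simpa [abs_of_nonneg hr0] using hr

theorem lintegral_enorm_sq_circleMap {f : ℂ → ℂ} (hf : DifferentiableOn ℂ f (ball 0 1))
    {r : ℝ} (hr0 : 0 ≤ r) (hr : r < 1) :
    ∫⁻ θ in Ioc 0 (2 * Real.pi), ‖f (circleMap 0 r θ)‖ₑ ^ 2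
      = ENNReal.ofReal (2 * Real.pi * Real.circleAverage (fun z => ‖f z‖ ^ 2) 0 r) := by
  have hc := continuous_comp_circleMap hf hr0 hr
  have h1 : ∀ θ : ℝ, ‖f (circleMap 0 r θ)‖ₑ ^ 2 = ENNReal.ofReal (‖f (circleMap 0 r θ)‖ ^ 2) := by
    intro θ
    rw [← ofReal_norm, ENNReal.ofReal_pow (norm_nonneg _)]
  simp_rw [h1]
  rw [← ofReal_integral_eq_lintegral_ofReal, ← intervalIntegral.integral_of_le Real.two_pi_pos.le,
    Real.circleAverage_def, smul_eq_mul, mul_inv_cancel_left₀ Real.two_pi_pos.ne']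
  · exact (hc.norm.pow 2).integrableOn_Icc.mono_set Ioc_subset_Icc_self
  · exact Eventually.of_forall fun θ => by positivity

theorem lintegral_Ioo_enorm_sq_circleMap {f : ℂ → ℂ} (hf : DifferentiableOn ℂ f (ball 0 1))
    {r : ℝ} (hr0 : 0 ≤ r) (hr : r < 1) :
    ∫⁻ θ in Ioo (-Real.pi) Real.pi, ‖f (circleMap 0 r θ)‖ₑ ^ 2
      = ENNReal.ofReal (2 * Real.pi * Real.circleAverage (fun z => ‖f z‖ ^ 2) 0 r) := by
  have hc := continuous_comp_circleMap hf hr0 hr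
  have h1 : ∀ θ : ℝ, ‖f (circleMap 0 r θ)‖ₑ ^ 2 = ENNReal.ofReal (‖f (circleMap 0 r θ)‖ ^ 2) := by
    intro θ
    rw [← ofReal_norm, ENNReal.ofReal_pow (norm_nonneg _)]
  simp_rw [h1]
  have hper : Function.Periodic (fun θ : ℝ => ‖f (circleMap 0 r θ)‖ ^ 2) (2 * Real.pi) :=
    fun θ => by simp [periodic_circleMap 0 r θ]
  have h2 := hper.intervalIntegral_add_eq (-Real.pi) 0
  rw [show -Real.pi + 2 * Real.pi = Real.pi by ring, zero_add] at h2
  rw [Measure.restrict_congr_set Ioo_ae_eq_Ioc, ← ofReal_integral_eq_lintegral_ofReal,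
    ← intervalIntegral.integral_of_le (by linarith [Real.pi_pos]),
    Real.circleAverage_def, smul_eq_mul, mul_inv_cancel_left₀ Real.two_pi_pos.ne', h2]
  · exact (hc.norm.pow 2).integrableOn_Icc.mono_set Ioc_subset_Icc_self
  · exact Eventually.of_forall fun θ => by positivity

/-- The square of the Hardy space norm, computed from the Taylor coefficients. -/
noncomputable def hardyEnergy (f : ℂ → ℂ) : ℝ≥0∞ :=
  ∑' n, ‖taylorCoeff f n‖ₑ ^ 2

theorem ofReal_circleAverage_sq {f : ℂ → ℂ} (hf : DifferentiableOn ℂ f (ball 0 1))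
    {r : ℝ} (hr0 : 0 ≤ r) (hr : r < 1) :
    ENNReal.ofReal (Real.circleAverage (fun z => ‖f z‖ ^ 2) 0 r)
      = ∑' n, ‖taylorCoeff f n‖ₑ ^ 2 * ENNReal.ofReal r ^ (2 * n) := by
  have h := hasSum_sq_taylorCoeff hf hr0 hr
  rw [← h.tsum_eq, ENNReal.ofReal_tsum_of_nonneg (fun n => by positivity) h.summable]
  congr 1
  ext n
  rw [ENNReal.ofReal_mul (by positivity), ENNReal.ofReal_pow (norm_nonneg _),
    ENNReal.ofReal_pow hr0, ofReal_norm]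

theorem ofReal_circleAverage_sq_le_hardyEnergy {f : ℂ → ℂ}
    (hf : DifferentiableOn ℂ f (ball 0 1)) {r : ℝ} (hr0 : 0 ≤ r) (hr : r < 1) :
    ENNReal.ofReal (Real.circleAverage (fun z => ‖f z‖ ^ 2) 0 r) ≤ hardyEnergy f := by
  rw [ofReal_circleAverage_sq hf hr0 hr]
  refine ENNReal.tsum_le_tsum fun n => ?_
  refine mul_le_of_le_one_right' (pow_le_one' ?_ _)
  simpa using hr.le

/-- A bound for the integral means bounds the Hardy norm. -/
theorem hardyEnergy_le {f : ℂ → ℂ} (hf : DifferentiableOn ℂ f (ball 0 1)) {M : ℝ≥0∞}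
    (hM : ∀ r ∈ Ioo (0 : ℝ) 1, ENNReal.ofReal (Real.circleAverage (fun z => ‖f z‖ ^ 2) 0 r) ≤ M) :
    hardyEnergy f ≤ M := by
  rw [hardyEnergy, ENNReal.tsum_eq_iSup_sum]
  refine iSup_le fun s => ?_
  have hlim : Tendsto (fun r : ℝ => ∑ n ∈ s, ‖taylorCoeff f n‖ₑ ^ 2 * ENNReal.ofReal r ^ (2 * n))
      (𝓝[<] 1) (𝓝 (∑ n ∈ s, ‖taylorCoeff f n‖ₑ ^ 2 * ENNReal.ofReal 1 ^ (2 * n))) := by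
    refine tendsto_finsetSum _ fun n _ => ?_
    refine ENNReal.Tendsto.const_mul ?_ (Or.inr (by finiteness))
    refine ENNReal.Tendsto.pow ?_
    exact (ENNReal.continuous_ofReal.tendsto 1).mono_left nhdsWithin_le_nhds
  simp only [ENNReal.ofReal_one, one_pow, mul_one] at hlim
  refine le_of_tendsto hlim ?_
  filter_upwards [Ioo_mem_nhdsLT (zero_lt_one : (0 : ℝ) < 1)] with r hr
  refine le_trans ?_ (hM r hr)
  rw [ofReal_circleAverage_sq hf hr.1.le hr.2]
  exact ENNReal.sum_le_tsum s

theorem iSup_circleAverage_sq {f : ℂ → ℂ} (hf : DifferentiableOn ℂ f (ball 0 1)) :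
    ⨆ r ∈ Ioo (0 : ℝ) 1, ENNReal.ofReal (1 / (2 * Real.pi)) *
      ∫⁻ θ in Ioc (0 : ℝ) (2 * Real.pi), ‖f (r * (Circle.exp θ : ℂ))‖ₑ ^ 2 = hardyEnergy f := by
  have h : ∀ r ∈ Ioo (0 : ℝ) 1, ENNReal.ofReal (1 / (2 * Real.pi)) *
      ∫⁻ θ in Ioc (0 : ℝ) (2 * Real.pi), ‖f (r * (Circle.exp θ : ℂ))‖ₑ ^ 2
      = ENNReal.ofReal (Real.circleAverage (fun z => ‖f z‖ ^ 2) 0 r) := by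
    intro r hr
    have := lintegral_enorm_sq_circleMap hf hr.1.le hr.2
    simp only [circleMap, zero_add] at this
    simp only [Circle.coe_exp]
    rw [this, ← ENNReal.ofReal_mul (by positivity)]
    congr 1
    field_simp
  rw [biSup_congr h]
  refine le_antisymm (iSup₂_le fun r hr => ofReal_circleAverage_sq_le_hardyEnergy hf hr.1.le hr.2)
    (hardyEnergy_le hf fun r hr => ?_)
  exact le_iSup₂ (f := fun r (_ : r ∈ Ioo (0 : ℝ) 1) =>
    ENNReal.ofReal (Real.circleAverage (fun z => ‖f z‖ ^ 2) 0 r)) r hr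

/-- The Dirichlet-type integral `(1 / π) ∫_𝔻 |f'(z)|² (1 - |z|²) dA(z)`. -/
noncomputable def bergmanEnergy (f : ℂ → ℂ) : ℝ≥0∞ :=
  ENNReal.ofReal (1 / Real.pi) *
    ∫⁻ z in ball (0 : ℂ) 1, ‖deriv f z‖ₑ ^ 2 * ENNReal.ofReal (1 - ‖z‖ ^ 2)

theorem lintegral_Ioo_pow_mul_one_sub_sq (n : ℕ) :
    ∫⁻ r in Ioo (0 : ℝ) 1, ENNReal.ofReal (2 * (r ^ (2 * n + 1) * (1 - r ^ 2)))
      = ENNReal.ofReal (1 / ((n + 1) * (n + 2))) := by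
  rw [Measure.restrict_congr_set Ioo_ae_eq_Ioc, ← ofReal_integral_eq_lintegral_ofReal,
    ← intervalIntegral.integral_of_le zero_le_one]
  · congr 1
    have : ∀ r : ℝ, 2 * (r ^ (2 * n + 1) * (1 - r ^ 2))
        = 2 * r ^ (2 * n + 1) - 2 * r ^ (2 * n + 3) := by
      intro r; ring
    simp_rw [this]
    rw [intervalIntegral.integral_sub (Continuous.intervalIntegrable (by fun_prop) _ _)
      (Continuous.intervalIntegrable (by fun_prop) _ _),
      intervalIntegral.integral_const_mul, intervalIntegral.integral_const_mul, integral_pow,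
      integral_pow]
    push_cast
    simp
    field_simp
    ring
  · have hc : Continuous fun r : ℝ => 2 * (r ^ (2 * n + 1) * (1 - r ^ 2)) := by fun_prop
    exact hc.integrableOn_Icc.mono_set Ioc_subset_Icc_self
  · refine (ae_restrict_iff' measurableSet_Ioc).2 (Eventually.of_forall fun r hr => ?_)
    have := hr.1
    have : r ^ 2 ≤ 1 := pow_le_one₀ hr.1.le hr.2
    have : 0 ≤ 1 - r ^ 2 := by linarith
    simp only [Pi.zero_apply]
    positivity

theorem lintegral_ball_mul_radial {k : ℂ → ℝ≥0∞} (hk : Measurable k) {W : ℝ → ℝ≥0∞}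
    (hW : Measurable W) :
    ∫⁻ z in ball (0 : ℂ) 1, k z * W ‖z‖ = ∫⁻ r in Ioo (0 : ℝ) 1,
      ENNReal.ofReal r * W r * ∫⁻ θ in Ioo (-Real.pi) Real.pi, k (circleMap 0 r θ) := by
  rw [← lintegral_indicator measurableSet_ball, ← Complex.lintegral_comp_polarCoord_symm]
  have hp : ∀ p : ℝ × ℝ, Complex.polarCoord.symm p = circleMap 0 p.1 p.2 := by
    intro p
    simp [circleMap, Complex.exp_mul_I]
  have htarget : polarCoord.target = Ioi (0 : ℝ) ×ˢ Ioo (-Real.pi) Real.pi := rfl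
  rw [htarget, setLIntegral_congr_fun (g := fun p : ℝ × ℝ => (Iio (1 : ℝ)).indicator
    (fun r => ENNReal.ofReal r * W r) p.1 * k (circleMap 0 p.1 p.2))
    (measurableSet_Ioi.prod measurableSet_Ioo)]
  · have hm : Measurable fun p : ℝ × ℝ => circleMap 0 p.1 p.2 := by
      unfold circleMap
      fun_prop
    have hi : Measurable ((Iio (1 : ℝ)).indicator (fun r => ENNReal.ofReal r * W r)) :=
      Measurable.indicator (by fun_prop) measurableSet_Iio
    rw [Measure.volume_eq_prod, ← Measure.prod_restrict, lintegral_prod]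
    · have h1 : ∀ r : ℝ, ∫⁻ θ in Ioo (-Real.pi) Real.pi, (Iio (1 : ℝ)).indicator
          (fun r => ENNReal.ofReal r * W r) r * k (circleMap 0 r θ)
          = (Iio (1 : ℝ)).indicator (fun r => ENNReal.ofReal r * W r *
            ∫⁻ θ in Ioo (-Real.pi) Real.pi, k (circleMap 0 r θ)) r := by
        intro r
        rw [lintegral_const_mul _ (by fun_prop)]
        by_cases hr : r ∈ Iio (1 : ℝ) <;> simp [hr]
      simp_rw [h1]
      rw [lintegral_indicator measurableSet_Iio, Measure.restrict_restrict measurableSet_Iio,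
        Iio_inter_Ioi]
    · exact ((hi.comp measurable_fst).mul (hk.comp hm)).aemeasurable
  · intro p hp'
    have h0 : 0 < p.1 := hp'.1
    simp only [hp]
    by_cases h1 : p.1 < 1
    · rw [indicator_of_mem (by simpa [abs_of_pos h0] using h1),
        indicator_of_mem (by simpa using h1)]
      simp [abs_of_pos h0]
      ring
    · rw [indicator_of_notMem (by simpa [abs_of_pos h0] using h1),
        indicator_of_notMem (by simpa using h1)]
      simp

theorem bergmanEnergy_eq_tsum {f : ℂ → ℂ} (hf : DifferentiableOn ℂ f (ball 0 1)) :
    bergmanEnergy f =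
      ∑' n : ℕ, ‖taylorCoeff f (n + 1)‖ₑ ^ 2 * ENNReal.ofReal ((n + 1) / (n + 2)) := by
  have hf' : DifferentiableOn ℂ (deriv f) (ball 0 1) := hf.deriv isOpen_ball
  have hmeas : Measurable fun z : ℂ => ‖deriv f z‖ₑ ^ 2 := by
    have := measurable_deriv f
    fun_prop
  rw [bergmanEnergy, lintegral_ball_mul_radial hmeas (W := fun r => ENNReal.ofReal (1 - r ^ 2))
    (by fun_prop), ← lintegral_const_mul' _ _ ENNReal.ofReal_ne_top]
  have h1 : ∀ r ∈ Ioo (0 : ℝ) 1, ENNReal.ofReal (1 / Real.pi) * (ENNReal.ofReal r *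
      ENNReal.ofReal (1 - r ^ 2) * ∫⁻ θ in Ioo (-Real.pi) Real.pi, ‖deriv f (circleMap 0 r θ)‖ₑ ^ 2)
      = ∑' n : ℕ, ‖taylorCoeff (deriv f) n‖ₑ ^ 2 *
        ENNReal.ofReal (2 * (r ^ (2 * n + 1) * (1 - r ^ 2))) := by
    intro r hr
    have hr1 : 0 ≤ 1 - r ^ 2 := by nlinarith [hr.1, hr.2]
    have hr0 := hr.1
    rw [lintegral_Ioo_enorm_sq_circleMap hf' hr.1.le hr.2, ENNReal.ofReal_mul (by positivity),
      ofReal_circleAverage_sq hf' hr.1.le hr.2, ← ENNReal.tsum_mul_left, ← ENNReal.tsum_mul_left,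
      ← ENNReal.tsum_mul_left]
    congr 1
    ext n
    have : ∀ a b c d e g : ℝ≥0∞, a * (b * c * (d * (e * g))) = e * (a * d * (b * c * g)) := by
      intros; ring
    rw [this, ← ENNReal.ofReal_pow hr.1.le, ← ENNReal.ofReal_mul (by positivity),
      ← ENNReal.ofReal_mul hr.1.le, ← ENNReal.ofReal_mul (by positivity),
      ← ENNReal.ofReal_mul (by positivity)]
    congr 2
    field_simp
    ring
  rw [setLIntegral_congr_fun measurableSet_Ioo h1, lintegral_tsum fun n => by fun_prop]
  congr 1
  ext n
  rw [lintegral_const_mul _ (by fun_prop), lintegral_Ioo_pow_mul_one_sub_sq, taylorCoeff_deriv,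
    enorm_mul, mul_pow]
  have h2 : ‖(n + 1 : ℂ)‖ₑ ^ 2 = ENNReal.ofReal ((n + 1) ^ 2) := by
    rw [← ofReal_norm, ← ENNReal.ofReal_pow (norm_nonneg _)]
    congr 2
    exact_mod_cast Complex.norm_natCast (n + 1)
  rw [h2, mul_comm (ENNReal.ofReal _), mul_assoc, ← ENNReal.ofReal_mul (by positivity)]
  congr 2
  field_simp

/-- Upper comparison of the area integral with the Hardy norm of `f - f 0`. -/
theorem bergmanEnergy_add_le_hardyEnergy {f : ℂ → ℂ} (hf : DifferentiableOn ℂ f (ball 0 1)) :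
    bergmanEnergy f + ‖f 0‖ₑ ^ 2 ≤ hardyEnergy f := by
  rw [bergmanEnergy_eq_tsum hf, hardyEnergy,
    tsum_eq_zero_add' (f := fun n => ‖taylorCoeff f n‖ₑ ^ 2) ENNReal.summable, taylorCoeff_zero,
    add_comm]
  gcongr with n
  refine mul_le_of_le_one_right' ?_
  rw [ENNReal.ofReal_le_one, div_le_one (by positivity)]
  linarith

/-- Lower comparison of the area integral with the Hardy norm of `f - f 0`: the coefficients
`(n + 1) / (n + 2)` are at least `1 / 2`. -/
theorem hardyEnergy_le_two_mul_bergmanEnergy_add {f : ℂ → ℂ}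
    (hf : DifferentiableOn ℂ f (ball 0 1)) :
    hardyEnergy f ≤ 2 * bergmanEnergy f + ‖f 0‖ₑ ^ 2 := by
  rw [bergmanEnergy_eq_tsum hf, hardyEnergy,
    tsum_eq_zero_add' (f := fun n => ‖taylorCoeff f n‖ₑ ^ 2) ENNReal.summable, taylorCoeff_zero,
    add_comm, ← ENNReal.tsum_mul_left]
  gcongr with n
  rw [mul_left_comm]
  refine le_mul_of_one_le_right' ?_
  rw [show (2 : ℝ≥0∞) = ENNReal.ofReal 2 by simp, ← ENNReal.ofReal_mul (by norm_num),
    ENNReal.one_le_ofReal, mul_div_assoc', one_le_div (by positivity)]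
  linarith [n.cast_nonneg (α := ℝ)]

/-! ### Möbius involutions of the disc -/

/-- The involution of the disc that exchanges `0` and `w`. -/
noncomputable def moebius (w z : ℂ) : ℂ := (w - z) / (1 - conj w * z)

theorem one_sub_conj_mul_ne_zero {w z : ℂ} (hw : ‖w‖ < 1) (hz : ‖z‖ ≤ 1) :
    1 - conj w * z ≠ 0 := by
  intro h
  have h1 : ‖conj w * z‖ < 1 := by
    rw [norm_mul, RCLike.norm_conj]
    exact (mul_le_of_le_one_right (norm_nonneg _) hz).trans_lt hw
  rw [sub_eq_zero] at h
  rw [← h, norm_one] at h1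
  exact lt_irrefl _ h1

theorem one_sub_conj_mul_ne_zero' {w z : ℂ} (hw : ‖w‖ ≤ 1) (hz : ‖z‖ < 1) :
    1 - conj w * z ≠ 0 := by
  have h := one_sub_conj_mul_ne_zero hz hw
  rw [← map_ne_zero (starRingEnd ℂ)]
  simpa [mul_comm] using h

theorem norm_sq_one_sub_conj_mul (w z : ℂ) :
    ‖1 - conj w * z‖ ^ 2 = ‖w - z‖ ^ 2 + (1 - ‖w‖ ^ 2) * (1 - ‖z‖ ^ 2) := by
  simp only [← Complex.normSq_eq_norm_sq, Complex.normSq_apply]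
  simp
  ring

theorem one_sub_norm_moebius_sq {w z : ℂ} (hw : ‖w‖ < 1) (hz : ‖z‖ ≤ 1) :
    1 - ‖moebius w z‖ ^ 2 = (1 - ‖w‖ ^ 2) * (1 - ‖z‖ ^ 2) / ‖1 - conj w * z‖ ^ 2 := by
  have h := norm_ne_zero_iff.2 (one_sub_conj_mul_ne_zero hw hz)
  rw [moebius, norm_div, div_pow, eq_div_iff (pow_ne_zero _ h), sub_mul,
    div_mul_cancel₀ _ (pow_ne_zero _ h), norm_sq_one_sub_conj_mul]
  ring

theorem norm_moebius_lt_one {w z : ℂ} (hw : ‖w‖ < 1) (hz : ‖z‖ < 1) : ‖moebius w z‖ < 1 := by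
  have h := norm_pos_iff.2 (one_sub_conj_mul_ne_zero hw hz.le)
  have h1 := one_sub_norm_moebius_sq hw hz.le
  have h2 : 0 < (1 - ‖w‖ ^ 2) * (1 - ‖z‖ ^ 2) / ‖1 - conj w * z‖ ^ 2 := by
    have : 0 < 1 - ‖w‖ ^ 2 := by nlinarith [norm_nonneg w]
    have : 0 < 1 - ‖z‖ ^ 2 := by nlinarith [norm_nonneg z]
    positivity
  nlinarith [norm_nonneg (moebius w z)]

theorem norm_moebius_eq_one {w z : ℂ} (hw : ‖w‖ < 1) (hz : ‖z‖ = 1) : ‖moebius w z‖ = 1 := by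
  have h1 := one_sub_norm_moebius_sq hw hz.le
  simp only [hz, one_pow, sub_self, mul_zero, zero_div, sub_eq_zero] at h1
  exact (pow_eq_one_iff_of_nonneg (norm_nonneg _) two_ne_zero).1 h1.symm

theorem norm_moebius_le_one {w z : ℂ} (hw : ‖w‖ < 1) (hz : ‖z‖ ≤ 1) : ‖moebius w z‖ ≤ 1 := by
  rcases hz.lt_or_eq with h | h
  · exact (norm_moebius_lt_one hw h).le
  · exact (norm_moebius_eq_one hw h).le

theorem moebius_zero (w : ℂ) : moebius w 0 = w := by simp [moebius]

theorem moebius_moebius {w z : ℂ} (hw : ‖w‖ < 1) (hz : ‖z‖ ≤ 1) :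
    moebius w (moebius w z) = z := by
  have h := one_sub_conj_mul_ne_zero hw hz
  have h' := one_sub_conj_mul_ne_zero hw (norm_moebius_le_one hw hz)
  unfold moebius at h' ⊢
  rw [div_eq_iff h']
  refine mul_right_cancel₀ h ?_
  have e : (w - z) / (1 - conj w * z) * (1 - conj w * z) = w - z := div_mul_cancel₀ _ h
  linear_combination (-1 + z * conj w) * e

theorem hasDerivAt_moebius {w z : ℂ} (hw : ‖w‖ < 1) (hz : ‖z‖ ≤ 1) :
    HasDerivAt (moebius w) (-(1 - (‖w‖ : ℂ) ^ 2) / (1 - conj w * z) ^ 2) z := by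
  have h := one_sub_conj_mul_ne_zero hw hz
  have h1 : HasDerivAt (moebius w) _ z := ((hasDerivAt_id z).const_sub w).div
    (((hasDerivAt_id z).const_mul (conj w)).const_sub 1) h
  refine h1.congr_deriv ?_
  rw [← Complex.conj_mul' w]
  simp
  ring

theorem differentiableOn_moebius {w : ℂ} (hw : ‖w‖ < 1) :
    DifferentiableOn ℂ (moebius w) (closedBall 0 1) := fun z hz =>
  (hasDerivAt_moebius hw (by simpa using hz)).differentiableAt.differentiableWithinAt

theorem moebius_image_ball {w : ℂ} (hw : ‖w‖ < 1) : moebius w '' ball 0 1 = ball 0 1 := by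
  ext z
  constructor
  · rintro ⟨u, hu, rfl⟩
    simpa using norm_moebius_lt_one hw (by simpa using hu)
  · intro hz
    have hz' : ‖z‖ < 1 := by simpa using hz
    exact ⟨moebius w z, by simpa using norm_moebius_lt_one hw hz', moebius_moebius hw hz'.le⟩

theorem mapsTo_moebius_ball {w : ℂ} (hw : ‖w‖ < 1) : MapsTo (moebius w) (ball 0 1) (ball 0 1) :=
  fun z hz => by simpa using norm_moebius_lt_one hw (by simpa using hz)

theorem differentiableOn_comp_moebius {f : ℂ → ℂ} (hf : DifferentiableOn ℂ f (ball 0 1)) {w : ℂ}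
    (hw : ‖w‖ < 1) : DifferentiableOn ℂ (f ∘ moebius w) (ball 0 1) :=
  hf.comp ((differentiableOn_moebius hw).mono ball_subset_closedBall) (mapsTo_moebius_ball hw)

/-- Change of variables for a holomorphic injection, whose real Jacobian is `|φ'|²`. -/
theorem lintegral_image_eq_lintegral_enorm_deriv_sq_mul {s : Set ℂ} (hs : MeasurableSet s)
    {φ φ' : ℂ → ℂ} (hφ : ∀ z ∈ s, HasDerivAt φ (φ' z) z) (hinj : InjOn φ s) (k : ℂ → ℝ≥0∞) :
    ∫⁻ z in φ '' s, k z = ∫⁻ z in s, ‖φ' z‖ₑ ^ 2 * k (φ z) := by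
  rw [lintegral_image_eq_lintegral_abs_det_fderiv_mul volume hs
    (fun z hz => ((hφ z hz).hasFDerivAt.restrictScalars ℝ).hasFDerivWithinAt) hinj]
  refine setLIntegral_congr_fun hs fun z hz => ?_
  have hdet : ((ContinuousLinearMap.toSpanSingleton ℂ (φ' z)).restrictScalars ℝ).det
      = ‖φ' z‖ ^ 2 := by
    simp [ContinuousLinearMap.det, LinearMap.det_restrictScalars, Algebra.norm_complex_eq,
      Complex.normSq_eq_norm_sq]
  simp only [hdet, abs_of_nonneg (sq_nonneg ‖φ' z‖)]
  rw [ENNReal.ofReal_pow (norm_nonneg _), ofReal_norm]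

/-- The local Dirichlet integral `(1 / π) ∫_𝔻 |f'(z)|² (1 - |z|²) / |1 - w̄ z|² dA(z)`; for a
boundary point `w` the weight is the Poisson kernel. -/
noncomputable def localEnergy (w : ℂ) (f : ℂ → ℂ) : ℝ≥0∞ :=
  ENNReal.ofReal (1 / Real.pi) * ∫⁻ z in ball (0 : ℂ) 1,
    ‖deriv f z‖ₑ ^ 2 * ENNReal.ofReal ((1 - ‖z‖ ^ 2) / ‖1 - conj w * z‖ ^ 2)

/-- Conformal invariance of the local Dirichlet integral. -/
theorem bergmanEnergy_comp_moebius {f : ℂ → ℂ} (hf : DifferentiableOn ℂ f (ball 0 1)) {w : ℂ}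
    (hw : ‖w‖ < 1) :
    bergmanEnergy (f ∘ moebius w) = ENNReal.ofReal (1 - ‖w‖ ^ 2) * localEnergy w f := by
  have hinj : InjOn (moebius w) (ball 0 1) := by
    intro x hx y hy hxy
    rw [← moebius_moebius hw (z := x) (by simpa using (mem_ball_zero_iff.1 hx).le), hxy,
      moebius_moebius hw (by simpa using (mem_ball_zero_iff.1 hy).le)]
  rw [localEnergy, mul_left_comm, ← lintegral_const_mul' _ _ ENNReal.ofReal_ne_top]
  conv_rhs => rw [← moebius_image_ball hw]
  rw [lintegral_image_eq_lintegral_enorm_deriv_sq_mul measurableSet_ball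
    (fun z hz => hasDerivAt_moebius hw (by simpa using (mem_ball_zero_iff.1 hz).le)) hinj,
    bergmanEnergy]
  congr 1
  refine setLIntegral_congr_fun measurableSet_ball fun z hz => ?_
  have hz1 : ‖z‖ < 1 := by simpa using hz
  have hφ : ‖moebius w z‖ < 1 := norm_moebius_lt_one hw hz1
  have h1 : deriv (f ∘ moebius w) z
      = deriv f (moebius w z) * (-(1 - (‖w‖ : ℂ) ^ 2) / (1 - conj w * z) ^ 2) := by
    have h2 : HasDerivAt f (deriv f (moebius w z)) (moebius w z) :=
      (hf.differentiableAt (isOpen_ball.mem_nhds (by simpa using hφ))).hasDerivAt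
    exact (h2.comp z (hasDerivAt_moebius hw hz1.le)).deriv
  have hw2 : 0 ≤ 1 - ‖w‖ ^ 2 := by nlinarith [norm_nonneg w]
  have h3 : 1 - ‖z‖ ^ 2 = (1 - ‖w‖ ^ 2) *
      ((1 - ‖moebius w z‖ ^ 2) / ‖1 - conj w * moebius w z‖ ^ 2) := by
    have := one_sub_norm_moebius_sq hw hφ.le
    rw [moebius_moebius hw hz1.le] at this
    rw [this, mul_div_assoc]
  simp only [h1, enorm_mul, mul_pow]
  rw [h3, ENNReal.ofReal_mul hw2]
  ring

/-! ### Harmonic measure and outer functions -/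

/-- Harmonic measure of the disc at `w`, in the angular coordinate `θ ∈ (0, 2π]`. -/
noncomputable def harmonicMeasure (w : ℂ) : Measure ℝ :=
  (volume.restrict (Ioc 0 (2 * Real.pi))).withDensity fun θ =>
    ENNReal.ofReal ((2 * Real.pi)⁻¹ * poissonKernel 0 w (circleMap 0 1 θ))

theorem poissonKernel_circleMap (w : ℂ) (θ : ℝ) :
    poissonKernel 0 w (circleMap 0 1 θ) = (1 - ‖w‖ ^ 2) / ‖circleMap 0 1 θ - w‖ ^ 2 := by
  simp [poissonKernel]

theorem poissonKernel_circleMap_nonneg {w : ℂ} (hw : ‖w‖ < 1) (θ : ℝ) :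
    0 ≤ poissonKernel 0 w (circleMap 0 1 θ) := by
  rw [poissonKernel_circleMap]
  have : 0 ≤ 1 - ‖w‖ ^ 2 := by nlinarith [norm_nonneg w]
  positivity

theorem circleMap_sub_ne_zero {w : ℂ} (hw : ‖w‖ < 1) (θ : ℝ) : circleMap 0 1 θ - w ≠ 0 := by
  intro h
  rw [sub_eq_zero] at h
  have := congrArg norm h
  simp at this
  exact hw.ne this.symm

theorem continuous_poissonKernel_circleMap {w : ℂ} (hw : ‖w‖ < 1) :
    Continuous fun θ => poissonKernel 0 w (circleMap 0 1 θ) := by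
  simp_rw [poissonKernel_circleMap]
  exact Continuous.div (by fun_prop) (by fun_prop) fun θ =>
    pow_ne_zero _ (norm_ne_zero_iff.2 (circleMap_sub_ne_zero hw θ))

theorem integral_harmonicMeasure {w : ℂ} (hw : ‖w‖ < 1) (U : ℂ → ℝ) :
    ∫ θ, U (circleMap 0 1 θ) ∂(harmonicMeasure w)
      = Real.circleAverage (poissonKernel 0 w • U) 0 1 := by
  have hc := continuous_poissonKernel_circleMap hw
  rw [harmonicMeasure, integral_withDensity_eq_integral_toReal_smul
    (hc.measurable.const_mul _).ennreal_ofReal (by simp),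
    Real.circleAverage_def, intervalIntegral.integral_of_le Real.two_pi_pos.le, smul_eq_mul,
    ← integral_const_mul]
  congr 1
  ext θ
  have := poissonKernel_circleMap_nonneg hw θ
  rw [ENNReal.toReal_ofReal (by positivity)]
  simp
  ring

theorem isProbabilityMeasure_harmonicMeasure {w : ℂ} (hw : ‖w‖ < 1) :
    IsProbabilityMeasure (harmonicMeasure w) := by
  have h1 := integral_harmonicMeasure hw fun _ => 1
  have h2 : Real.circleAverage (poissonKernel 0 w • fun _ => (1 : ℝ)) 0 1 = 1 := by
    have h3 : InnerProductSpace.HarmonicContOnCl (fun _ : ℂ => (1 : ℝ)) (ball 0 1) :=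
      InnerProductSpace.harmonicContOnCl_const
    exact h3.circleAverage_poissonKernel_smul (by simpa using hw)
  rw [h2] at h1
  simp only [integral_const, smul_eq_mul, mul_one, Measure.real] at h1
  exact ⟨(ENNReal.toReal_eq_one_iff _).1 h1⟩

theorem harmonicMeasure_absolutelyContinuous (w : ℂ) :
    harmonicMeasure w ≪ volume.restrict (Ioc 0 (2 * Real.pi)) :=
  withDensity_absolutelyContinuous _ _

theorem integrable_harmonicMeasure {w : ℂ} (hw : ‖w‖ < 1) {v : ℝ → ℝ} (hv : Measurable v) {C : ℝ}
    (hC : ∀ θ, |v θ| ≤ C) : Integrable v (harmonicMeasure w) := by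
  have := isProbabilityMeasure_harmonicMeasure hw
  exact Integrable.of_bound hv.aestronglyMeasurable C (Eventually.of_forall hC)

theorem circleIntegrable_of_bounded {V : ℂ → ℝ} (hV : Measurable fun θ => V (circleMap 0 1 θ))
    {C : ℝ} (hC : ∀ θ, |V (circleMap 0 1 θ)| ≤ C) : CircleIntegrable V 0 1 := by
  rw [CircleIntegrable, intervalIntegrable_iff]
  rw [uIoc_of_le Real.two_pi_pos.le]
  exact Integrable.of_bound hV.aestronglyMeasurable C (Eventually.of_forall hC)

/-- The Herglotz integral of `V`: the holomorphic function whose real part is the Poisson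
integral of `V`. -/
noncomputable def herglotzIntegral (V : ℂ → ℝ) (z : ℂ) : ℂ :=
  Real.circleAverage (fun ζ => herglotzRieszKernel 0 z ζ • (V ζ : ℂ)) 0 1

theorem differentiableOn_herglotzIntegral {V : ℂ → ℝ} (hV : CircleIntegrable V 0 1) :
    DifferentiableOn ℂ (herglotzIntegral V) (ball 0 1) := by
  refine differentiableOn_circleAverage_herglotzRieszKernel_smul ?_
  simp only [CircleIntegrable, intervalIntegrable_iff] at hV ⊢
  exact Complex.ofRealCLM.integrable_comp hV

theorem re_herglotzIntegral {V : ℂ → ℝ} (hV : CircleIntegrable V 0 1) {z : ℂ} (hz : ‖z‖ < 1) :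
    (herglotzIntegral V z).re = ∫ θ, V (circleMap 0 1 θ) ∂(harmonicMeasure z) := by
  rw [herglotzIntegral, re_circleAverage_herglotzRieszKernel_smul hV (by simpa using hz),
    integral_harmonicMeasure hz, poissonKernel_eq_re_herglotzRieszKernel]

/-- The outer function with boundary modulus `exp V`. -/
noncomputable def outerFunction (V : ℂ → ℝ) (z : ℂ) : ℂ := Complex.exp (herglotzIntegral V z)

theorem differentiableOn_outerFunction {V : ℂ → ℝ} (hV : CircleIntegrable V 0 1) :
    DifferentiableOn ℂ (outerFunction V) (ball 0 1) :=
  (differentiableOn_herglotzIntegral hV).cexp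

theorem norm_outerFunction {V : ℂ → ℝ} (hV : CircleIntegrable V 0 1) {z : ℂ} (hz : ‖z‖ < 1) :
    ‖outerFunction V z‖ = Real.exp (∫ θ, V (circleMap 0 1 θ) ∂(harmonicMeasure z)) := by
  rw [outerFunction, Complex.norm_exp, re_herglotzIntegral hV hz]

theorem norm_outerFunction_sq {V : ℂ → ℝ} (hV : CircleIntegrable V 0 1) {z : ℂ} (hz : ‖z‖ < 1) :
    ‖outerFunction V z‖ ^ 2
      = Real.exp (∫ θ, 2 * V (circleMap 0 1 θ) ∂(harmonicMeasure z)) := by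
  rw [norm_outerFunction hV hz, ← Real.exp_nat_mul, integral_const_mul]
  simp

/-- If `|h|²` is dominated by the real part of a holomorphic function `k`, then the Hardy norm
of `h` is bounded by the value of `k` at the origin. -/
theorem hardyEnergy_le_of_majorant {h k : ℂ → ℂ} (hh : DifferentiableOn ℂ h (ball 0 1))
    (hk : DifferentiableOn ℂ k (ball 0 1)) (hhk : ∀ z ∈ ball (0 : ℂ) 1, ‖h z‖ ^ 2 ≤ (k z).re) :
    hardyEnergy h ≤ ENNReal.ofReal (k 0).re := by
  refine hardyEnergy_le hh fun r hr => ENNReal.ofReal_le_ofReal ?_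
  have hsub : closedBall (0 : ℂ) r ⊆ ball 0 1 := closedBall_subset_ball hr.2
  have hsub' : sphere (0 : ℂ) r ⊆ ball 0 1 := sphere_subset_closedBall.trans hsub
  have h1 : DiffContOnCl ℂ k (ball 0 |r|) := by
    rw [abs_of_pos hr.1]
    refine DifferentiableOn.diffContOnCl (hk.mono ?_)
    rwa [closure_ball _ hr.1.ne']
  have hki : CircleIntegrable k 0 r :=
    (hk.continuousOn.mono hsub').circleIntegrable hr.1.le
  have h2 : Real.circleAverage (fun z => (k z).re) 0 r = (k 0).re := by
    rw [← h1.circleAverage]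
    exact Complex.reCLM.circleAverage_comp_comm hki
  rw [← h2]
  refine Real.circleAverage_mono ?_ ?_ fun z hz =>
    hhk z (hsub' (by simpa [abs_of_pos hr.1] using hz))
  · exact ((hh.continuousOn.mono hsub').norm.pow 2).circleIntegrable hr.1.le
  · exact (Complex.continuous_re.comp_continuousOn (hk.continuousOn.mono hsub')).circleIntegrable
      hr.1.le

section
variable {V : ℂ → ℝ} {C : ℝ}

theorem abs_exp_two_mul_le (hC : ∀ θ, |V (circleMap 0 1 θ)| ≤ C) (θ : ℝ) :
    |Real.exp (2 * V (circleMap 0 1 θ))| ≤ Real.exp (2 * C) := by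
  rw [Real.abs_exp, Real.exp_le_exp]
  linarith [le_abs_self (V (circleMap 0 1 θ)), hC θ]

/-- Jensen's inequality: `|exp H|²` is dominated by the Poisson integral of its boundary values. -/
theorem norm_outerFunction_sq_le (hV : Measurable fun θ => V (circleMap 0 1 θ))
    (hC : ∀ θ, |V (circleMap 0 1 θ)| ≤ C) {z : ℂ} (hz : ‖z‖ < 1) :
    ‖outerFunction V z‖ ^ 2 ≤ (herglotzIntegral (fun ζ => Real.exp (2 * V ζ)) z).re := by
  have hVe : Measurable fun θ => Real.exp (2 * V (circleMap 0 1 θ)) :=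
    Real.measurable_exp.comp (hV.const_mul 2)
  have := isProbabilityMeasure_harmonicMeasure hz
  rw [norm_outerFunction_sq (circleIntegrable_of_bounded hV hC) hz,
    re_herglotzIntegral (circleIntegrable_of_bounded hVe (abs_exp_two_mul_le hC)) hz]
  exact convexOn_exp.map_integral_le Real.continuous_exp.continuousOn isClosed_univ
    (by simp) ((integrable_harmonicMeasure hz hV hC).const_mul 2)
    (integrable_harmonicMeasure hz hVe (abs_exp_two_mul_le hC))

theorem hardyEnergy_outerFunction_comp_le (hV : Measurable fun θ => V (circleMap 0 1 θ))
    (hC : ∀ θ, |V (circleMap 0 1 θ)| ≤ C) {w : ℂ} (hw : ‖w‖ < 1) :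
    hardyEnergy (outerFunction V ∘ moebius w)
      ≤ ENNReal.ofReal (∫ θ, Real.exp (2 * V (circleMap 0 1 θ)) ∂(harmonicMeasure w)) := by
  have hVe : Measurable fun θ => Real.exp (2 * V (circleMap 0 1 θ)) :=
    Real.measurable_exp.comp (hV.const_mul 2)
  have hint := circleIntegrable_of_bounded (V := fun ζ => Real.exp (2 * V ζ)) hVe
    (abs_exp_two_mul_le hC)
  have h := hardyEnergy_le_of_majorant
    (differentiableOn_comp_moebius
      (differentiableOn_outerFunction (circleIntegrable_of_bounded hV hC)) hw)
    (differentiableOn_comp_moebius (differentiableOn_herglotzIntegral hint) hw)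
    fun z hz => norm_outerFunction_sq_le hV hC
      (norm_moebius_lt_one hw (by simpa using hz))
  rwa [Function.comp_apply, moebius_zero, re_herglotzIntegral hint hw] at h

/-- The local Dirichlet integral of an outer function is controlled by the defect in Jensen's
inequality for its boundary modulus. -/
theorem localEnergy_outerFunction_add_le (hV : Measurable fun θ => V (circleMap 0 1 θ))
    (hC : ∀ θ, |V (circleMap 0 1 θ)| ≤ C) {w : ℂ} (hw : ‖w‖ < 1) :
    ENNReal.ofReal (1 - ‖w‖ ^ 2) * localEnergy w (outerFunction V) +
        ENNReal.ofReal (Real.exp (∫ θ, 2 * V (circleMap 0 1 θ) ∂(harmonicMeasure w)))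
      ≤ ENNReal.ofReal (∫ θ, Real.exp (2 * V (circleMap 0 1 θ)) ∂(harmonicMeasure w)) := by
  have hd := differentiableOn_outerFunction (circleIntegrable_of_bounded hV hC)
  refine le_trans ?_ (hardyEnergy_outerFunction_comp_le hV hC hw)
  rw [← bergmanEnergy_comp_moebius hd hw]
  refine le_trans (le_of_eq ?_)
    (bergmanEnergy_add_le_hardyEnergy (differentiableOn_comp_moebius hd hw))
  congr 1
  rw [Function.comp_apply, moebius_zero, ← ofReal_norm, ← ENNReal.ofReal_pow (norm_nonneg _),
    norm_outerFunction_sq (circleIntegrable_of_bounded hV hC) hw]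

end

/-- Harmonic measure at `w` is the image of normalized arc length under the Möbius involution
exchanging `0` and `w`. -/
theorem integral_harmonicMeasure_eq_circleAverage_comp_moebius {w : ℂ} (hw : ‖w‖ < 1) {u : ℂ → ℝ}
    (hu : ContinuousOn u (sphere 0 1)) :
    ∫ θ, u (circleMap 0 1 θ) ∂(harmonicMeasure w) = Real.circleAverage (u ∘ moebius w) 0 1 := by
  set P : ℝ → ℝ := fun θ => poissonKernel 0 w (circleMap 0 1 θ) with hP
  have hPc : Continuous P := continuous_poissonKernel_circleMap hw
  have hPint : ∫ θ in (0 : ℝ)..2 * Real.pi, P θ = 2 * Real.pi := by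
    have h1 := integral_harmonicMeasure hw fun _ => 1
    have := isProbabilityMeasure_harmonicMeasure hw
    rw [Real.circleAverage_def] at h1
    simp only [integral_const, probReal_univ, smul_eq_mul, mul_one, Pi.smul_apply'] at h1
    rw [eq_comm, inv_mul_eq_one₀ Real.two_pi_pos.ne'] at h1
    exact h1.symm
  have hsphere : ∀ θ : ℝ, moebius w (circleMap 0 1 θ) ∈ sphere (0 : ℂ) 1 := fun θ => by
    simpa using norm_moebius_eq_one hw (by simp)
  -- On the circle, the argument of the involution increases at the rate `P`.
  obtain ⟨a, ha⟩ : ∃ a : ℝ, circleMap 0 1 a = moebius w (circleMap 0 1 0) := by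
    have := hsphere 0
    rwa [← abs_one (α := ℝ), ← range_circleMap, abs_one] at this
  set γ : ℝ → ℝ := fun θ => a + ∫ t in (0 : ℝ)..θ, P t with hγ
  have hγd : ∀ θ, HasDerivAt γ (P θ) θ := fun θ =>
    (intervalIntegral.integral_hasDerivAt_right (hPc.intervalIntegrable _ _)
      (hPc.stronglyMeasurableAtFilter _ _) hPc.continuousAt).const_add a
  have hψ : ∀ θ : ℝ, HasDerivAt (fun t => moebius w (circleMap 0 1 t))
      (Complex.I * P θ * moebius w (circleMap 0 1 θ)) θ := by
    intro θ
    have h1 := (hasDerivAt_moebius hw (z := circleMap 0 1 θ) (by simp)).comp θ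
      (hasDerivAt_circleMap 0 1 θ)
    refine h1.congr_deriv ?_
    have hz1 : ‖circleMap 0 1 θ‖ = 1 := by simp
    set z := circleMap 0 1 θ with hz
    have hz0 : z ≠ 0 := by rw [← norm_ne_zero_iff, hz1]; norm_num
    have h3 := one_sub_conj_mul_ne_zero hw hz1.le
    have h4 : z - w ≠ 0 := circleMap_sub_ne_zero hw θ
    have h5 : ((‖z - w‖ : ℂ)) ^ 2 * z = (z - w) * (1 - conj w * z) := by
      rw [← Complex.mul_conj', map_sub, mul_assoc, sub_mul (conj z), Complex.conj_mul', hz1]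
      simp
    have h6 : (‖z - w‖ : ℂ) ^ 2 ≠ 0 := by
      simpa using h4
    have h7 : ((P θ : ℝ) : ℂ) = (1 - (‖w‖ : ℂ) ^ 2) / (‖z - w‖ : ℂ) ^ 2 := by
      simp only [hP, poissonKernel_circleMap]
      push_cast
      rfl
    rw [h7, moebius]
    rw [div_mul_eq_mul_div, mul_div_assoc', mul_div_assoc', div_mul_eq_mul_div, div_div,
      div_eq_div_iff (pow_ne_zero _ h3)
      (mul_ne_zero h6 h3)]
    linear_combination (-(1 - (‖w‖ : ℂ) ^ 2)) * Complex.I * (1 - conj w * z) * h5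
  have hγψ : ∀ θ, moebius w (circleMap 0 1 θ) = circleMap 0 1 (γ θ) := by
    have hd : ∀ θ : ℝ, HasDerivAt
        (fun t => moebius w (circleMap 0 1 t) * Complex.exp (-(Complex.I * γ t))) 0 θ := by
      intro θ
      have h1 := (hψ θ).mul (((hγd θ).ofReal_comp.const_mul Complex.I).neg.cexp)
      refine h1.congr_deriv ?_
      ring
    intro θ
    have h2 := is_const_of_deriv_eq_zero (fun t => (hd t).differentiableAt)
      (fun t => (hd t).deriv) θ 0
    have h3 : γ 0 = a := by simp [hγ]
    simp only [h3] at h2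
    rw [← ha] at h2
    have h4 : circleMap 0 1 a * Complex.exp (-(Complex.I * a)) = 1 := by
      simp [circleMap, ← Complex.exp_add, mul_comm]
    rw [h4, Complex.exp_neg, mul_inv_eq_one₀ (Complex.exp_ne_zero _)] at h2
    rw [h2]
    simp [circleMap, mul_comm]
  have key : ∀ U : ℂ → ℝ, ContinuousOn U (sphere 0 1) →
      Real.circleAverage (poissonKernel 0 w • (U ∘ moebius w)) 0 1 = Real.circleAverage U 0 1 := by
    intro U hU
    have hUc : Continuous fun t : ℝ => U (circleMap 0 1 t) :=
      hU.comp_continuous (by fun_prop) fun t => by simp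
    have h1 := intervalIntegral.integral_comp_mul_deriv (a := 0) (b := 2 * Real.pi)
      (fun x _ => hγd x) hPc.continuousOn hUc
    have hper : Function.Periodic (fun t : ℝ => U (circleMap 0 1 t)) (2 * Real.pi) :=
      fun t => by simp [periodic_circleMap 0 1 t]
    have h2 : γ (2 * Real.pi) = γ 0 + 2 * Real.pi := by simp [hγ, hPint]
    rw [h2, hper.intervalIntegral_add_eq (γ 0) 0, zero_add] at h1
    rw [Real.circleAverage_def, Real.circleAverage_def, ← h1]
    congr 2
    ext θ
    simp only [Pi.smul_apply', Function.comp_apply, hγψ, smul_eq_mul]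
    exact mul_comm _ _
  rw [integral_harmonicMeasure hw, ← key (u ∘ moebius w)]
  · refine Real.circleAverage_congr_sphere fun z hz => ?_
    have hz1 : ‖z‖ = 1 := by simpa using hz
    simp [moebius_moebius hw hz1.le]
  · refine hu.comp ((differentiableOn_moebius hw).continuousOn.mono sphere_subset_closedBall) ?_
    intro z hz
    simpa using norm_moebius_eq_one hw (by simpa using hz)

/-! ### Truncation and Jensen's inequality -/

/-- Cutting off `X` at height `1` decreases the defect `∫ X - exp (∫ log X)` in Jensen's
inequality. -/
theorem integral_min_one_sub_exp_le {α : Type*} [MeasurableSpace α] {ν : Measure α}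
    [IsProbabilityMeasure ν] {X : α → ℝ} (hX : Measurable X) {δ C : ℝ} (hδ : 0 < δ)
    (hXδ : ∀ x, δ ≤ X x) (hXC : ∀ x, X x ≤ C) :
    ∫ x, min (X x) 1 ∂ν - Real.exp (∫ x, Real.log (min (X x) 1) ∂ν)
      ≤ ∫ x, X x ∂ν - Real.exp (∫ x, Real.log (X x) ∂ν) := by
  have hX0 : ∀ x, 0 < X x := fun x => hδ.trans_le (hXδ x)
  have hbd : ∀ {Y : α → ℝ}, Measurable Y → ∀ a b : ℝ, (∀ x, a ≤ Y x) → (∀ x, Y x ≤ b) →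
      Integrable Y ν := by
    intro Y hY a b ha hb
    refine Integrable.of_bound hY.aestronglyMeasurable (max |a| |b|)
      (Eventually.of_forall fun x => ?_)
    exact abs_le_max_abs_abs (ha x) (hb x)
  have hmin : Measurable fun x => min (X x) 1 := hX.min measurable_const
  have hXi : Integrable X ν := hbd hX δ C hXδ hXC
  have hLi : Integrable (fun x => Real.log (X x)) ν :=
    hbd (Real.measurable_log.comp hX) (Real.log δ) (Real.log C)
      (fun x => Real.log_le_log hδ (hXδ x)) (fun x => Real.log_le_log (hX0 x) (hXC x))
  have hmi : Integrable (fun x => min (X x) 1) ν :=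
    hbd hmin 0 1 (fun x => le_min (hX0 x).le zero_le_one) (fun x => min_le_right _ _)
  have hm0 : ∀ x, 0 < min (X x) 1 := fun x => lt_min (hX0 x) one_pos
  have hLmi : Integrable (fun x => Real.log (min (X x) 1)) ν :=
    hbd (Real.measurable_log.comp hmin) (Real.log (min δ 1)) 0
      (fun x => Real.log_le_log (lt_min hδ one_pos) (min_le_min_right _ (hXδ x)))
      (fun x => Real.log_nonpos (hm0 x).le (min_le_right _ _))
  set d : α → ℝ := fun x => Real.log (X x) - Real.log (min (X x) 1) with hd
  have hdi : Integrable d ν := hLi.sub hLmi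
  have hXm : ∀ x, X x - min (X x) 1 = Real.exp (d x) - 1 := by
    intro x
    simp only [hd]
    rcases le_total (X x) 1 with h | h
    · simp [min_eq_left h]
    · simp [min_eq_right h, Real.exp_log (hX0 x)]
  have hd0 : ∀ x, 0 ≤ d x := fun x =>
    sub_nonneg.2 (Real.log_le_log (hm0 x) (min_le_left _ _))
  have hei : Integrable (fun x => Real.exp (d x)) ν := by
    have : (fun x => Real.exp (d x)) = fun x => X x - min (X x) 1 + 1 := by
      ext x
      rw [hXm]
      ring
    rw [this]
    exact (hXi.sub hmi).add (integrable_const 1)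
  have h1 : Real.exp (∫ x, d x ∂ν) ≤ ∫ x, Real.exp (d x) ∂ν :=
    convexOn_exp.map_integral_le Real.continuous_exp.continuousOn isClosed_univ (by simp) hdi hei
  have h2 : ∫ x, X x ∂ν - ∫ x, min (X x) 1 ∂ν = ∫ x, Real.exp (d x) ∂ν - 1 := by
    rw [← integral_sub hXi hmi]
    simp_rw [hXm]
    rw [integral_sub hei (integrable_const 1)]
    simp
  have h3 : ∫ x, Real.log (X x) ∂ν = ∫ x, d x ∂ν + ∫ x, Real.log (min (X x) 1) ∂ν := by
    rw [hd, integral_sub hLi hLmi]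
    ring
  have h4 : Real.exp (∫ x, Real.log (min (X x) 1) ∂ν) ≤ 1 := by
    rw [Real.exp_le_one_iff]
    exact integral_nonpos fun x => Real.log_nonpos (hm0 x).le (min_le_right _ _)
  have h5 : 1 ≤ Real.exp (∫ x, d x ∂ν) := Real.one_le_exp (integral_nonneg hd0)
  rw [h3, Real.exp_add]
  nlinarith [Real.exp_pos (∫ x, Real.log (min (X x) 1) ∂ν)]

/-- Jensen's inequality for the logarithm of the modulus of an analytic function. -/
theorem log_norm_le_circleAverage_log_norm {h : ℂ → ℂ} (hh : AnalyticOnNhd ℂ h (closedBall 0 1))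
    (h0 : h 0 ≠ 0) : Real.log ‖h 0‖ ≤ Real.circleAverage (fun z => Real.log ‖h z‖) 0 1 := by
  have hh' : AnalyticOnNhd ℂ h (closedBall 0 |1|) := by rwa [abs_one]
  rw [hh'.circleAverage_log_norm one_ne_zero h0]
  refine le_add_of_nonneg_left (finsum_nonneg fun u => ?_)
  by_cases hu : u ∈ closedBall (0 : ℂ) |1|
  · refine mul_nonneg (by exact_mod_cast MeromorphicOn.AnalyticOnNhd.divisor_nonneg hh' u) ?_
    have hu1 : ‖u‖ ≤ 1 := by simpa using hu
    rw [one_mul, zero_sub, norm_neg, Real.log_inv, neg_nonneg]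
    exact Real.log_nonpos (norm_nonneg _) hu1
  · rw [Function.locallyFinsuppWithin.apply_eq_zero_of_notMem _ hu]
    simp

/-- Subharmonicity of `log (1 + |H|²)`. -/
theorem log_norm_sq_add_one_le_circleAverage {H : ℂ → ℂ}
    (hH : AnalyticOnNhd ℂ H (closedBall 0 1)) :
    Real.log (‖H 0‖ ^ 2 + 1) ≤ Real.circleAverage (fun z => Real.log (‖H z‖ ^ 2 + 1)) 0 1 := by
  -- `log (1 + |H|²)` is the largest of the functions `2 log |a H + b|` with `|a|² + |b|² = 1`;
  -- the pair is chosen so that equality holds at the origin.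
  set N : ℝ := √(‖H 0‖ ^ 2 + 1) with hN
  have hN2 : N ^ 2 = ‖H 0‖ ^ 2 + 1 := Real.sq_sqrt (by positivity)
  have hN0 : 0 < N := Real.sqrt_pos.2 (by positivity)
  set h : ℂ → ℂ := fun z => (conj (H 0) * H z + 1) / N with hh
  have hN0' : (N : ℂ) ≠ 0 := by exact_mod_cast hN0.ne'
  have hh0 : h 0 = N := by
    simp only [hh]
    rw [div_eq_iff hN0', Complex.conj_mul']
    exact_mod_cast (by rw [← hN2]; ring)
  have hle : ∀ z, ‖h z‖ ^ 2 ≤ ‖H z‖ ^ 2 + 1 := by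
    intro z
    have h1 : ‖h z‖ ≤ (‖H 0‖ * ‖H z‖ + 1) / N := by
      simp only [hh]
      rw [norm_div, Complex.norm_of_nonneg hN0.le]
      gcongr
      refine (norm_add_le _ _).trans ?_
      simp
    calc ‖h z‖ ^ 2 ≤ ((‖H 0‖ * ‖H z‖ + 1) / N) ^ 2 := by gcongr
      _ = (‖H 0‖ * ‖H z‖ + 1) ^ 2 / (‖H 0‖ ^ 2 + 1) := by rw [div_pow, hN2]
      _ ≤ ‖H z‖ ^ 2 + 1 := by
        rw [div_le_iff₀ (by positivity)]
        nlinarith [sq_nonneg (‖H 0‖ - ‖H z‖)]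
  have han : AnalyticOnNhd ℂ h (closedBall 0 1) := fun z hz =>
    ((analyticAt_const.mul (hH z hz)).add analyticAt_const).div_const
  have h1 := log_norm_le_circleAverage_log_norm han (by rw [hh0]; exact hN0')
  have h2 : Real.log (‖H 0‖ ^ 2 + 1) = 2 * Real.log ‖h 0‖ := by
    rw [hh0, Complex.norm_of_nonneg hN0.le, ← hN2, Real.log_pow]
    simp
  have hc : ContinuousOn (fun z => Real.log (‖H z‖ ^ 2 + 1)) (sphere 0 1) := by
    have hc0 : ContinuousOn H (sphere 0 1) := hH.continuousOn.mono sphere_subset_closedBall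
    exact ContinuousOn.log (by fun_prop) fun z _ => by positivity
  have h3 : Real.circleAverage (fun z => Real.log ‖h z‖) 0 1
      ≤ Real.circleAverage (fun z => 2⁻¹ * Real.log (‖H z‖ ^ 2 + 1)) 0 1 := by
    refine Real.circleAverage_mono ?_ ?_ fun z _ => ?_
    · refine MeromorphicOn.circleIntegrable_log_norm fun z hz => (han z ?_).meromorphicAt
      exact sphere_subset_closedBall (by simpa using hz)
    · exact (hc.const_mul _).circleIntegrable zero_le_one
    · by_cases hz : h z = 0
      · rw [hz, norm_zero, Real.log_zero]
        have : 0 ≤ Real.log (‖H z‖ ^ 2 + 1) := Real.log_nonneg (by nlinarith [sq_nonneg ‖H z‖])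
        positivity
      · have := Real.log_le_log (by positivity) (hle z)
        rw [Real.log_pow] at this
        push_cast at this
        linarith
  have h4 : Real.circleAverage (fun z => 2⁻¹ * Real.log (‖H z‖ ^ 2 + 1)) 0 1
      = 2⁻¹ * Real.circleAverage (fun z => Real.log (‖H z‖ ^ 2 + 1)) 0 1 :=
    Real.circleAverage_fun_smul (a := (2⁻¹ : ℝ)) (f := fun z => Real.log (‖H z‖ ^ 2 + 1))
  linarith

theorem analyticOnNhd_comp_moebius {F : ℂ → ℂ} (hF : AnalyticOnNhd ℂ F (closedBall 0 1)) {w : ℂ}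
    (hw : ‖w‖ < 1) : AnalyticOnNhd ℂ (F ∘ moebius w) (closedBall 0 1) := by
  intro z hz
  have hz1 : ‖z‖ ≤ 1 := by simpa using hz
  refine (hF _ (by simpa using norm_moebius_le_one hw hz1)).comp ?_
  refine AnalyticAt.div ?_ ?_ (one_sub_conj_mul_ne_zero hw hz1)
  · exact analyticAt_const.sub analyticAt_id
  · exact analyticAt_const.sub (analyticAt_const.mul analyticAt_id)

/-- Subharmonicity of `log (|F|² + ε²)`, with respect to harmonic measure at any point. -/
theorem norm_sq_add_le_exp_integral_log {F : ℂ → ℂ} (hF : AnalyticOnNhd ℂ F (closedBall 0 1))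
    {ε : ℝ} (hε : 0 < ε) {w : ℂ} (hw : ‖w‖ < 1) :
    ‖F w‖ ^ 2 + ε ^ 2 ≤ Real.exp (∫ θ, Real.log (‖F (circleMap 0 1 θ)‖ ^ 2 + ε ^ 2)
      ∂(harmonicMeasure w)) := by
  have hc0 : ContinuousOn F (sphere 0 1) := hF.continuousOn.mono sphere_subset_closedBall
  have hc : ContinuousOn (fun z => Real.log (‖F z‖ ^ 2 + ε ^ 2)) (sphere 0 1) :=
    ContinuousOn.log (by fun_prop) fun z _ => by positivity
  rw [integral_harmonicMeasure_eq_circleAverage_comp_moebius hw hc,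
    ← Real.log_le_iff_le_exp (by positivity)]
  have hsc : ∀ x : ℝ, Real.log (x ^ 2 + ε ^ 2) = 2 * Real.log ε + Real.log ((x / ε) ^ 2 + 1) := by
    intro x
    rw [show x ^ 2 + ε ^ 2 = ε ^ 2 * ((x / ε) ^ 2 + 1) by field_simp,
      Real.log_mul (by positivity) (by positivity), Real.log_pow]
    simp
  have hH : AnalyticOnNhd ℂ (fun z => (F ∘ moebius w) z / ε) (closedBall 0 1) := fun z hz =>
    (analyticOnNhd_comp_moebius hF hw z hz).div_const
  have h1 := log_norm_sq_add_one_le_circleAverage hH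
  simp only [norm_div, Complex.norm_of_nonneg hε.le, Function.comp_apply, moebius_zero] at h1
  have h2 : Real.circleAverage ((fun z => Real.log (‖F z‖ ^ 2 + ε ^ 2)) ∘ moebius w) 0 1
      = 2 * Real.log ε +
        Real.circleAverage (fun z => Real.log ((‖F (moebius w z)‖ / ε) ^ 2 + 1)) 0 1 := by
    have h3 : ContinuousOn (fun z => Real.log ((‖F (moebius w z)‖ / ε) ^ 2 + 1)) (sphere 0 1) := by
      have : ContinuousOn (fun z => F (moebius w z)) (sphere 0 1) :=
        (analyticOnNhd_comp_moebius hF hw).continuousOn.mono sphere_subset_closedBall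
      exact ContinuousOn.log (((this.norm.div_const ε).pow 2).add continuousOn_const)
        fun z _ => by positivity
    rw [← Real.circleAverage_const (2 * Real.log ε) 0 1, ← Real.circleAverage_fun_add
      (circleIntegrable_const _ _ _) (h3.circleIntegrable zero_le_one)]
    congr 1
    ext z
    simp only [Function.comp_apply, hsc]
  rw [h2, hsc]
  linarith

/-- The mean of `|F|²` over harmonic measure is at most `|F|²` plus twice the local Dirichlet
integral. -/
theorem ofReal_integral_norm_sq_le {F : ℂ → ℂ} (hF : AnalyticOnNhd ℂ F (closedBall 0 1))
    {w : ℂ} (hw : ‖w‖ < 1) :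
    ENNReal.ofReal (∫ θ, ‖F (circleMap 0 1 θ)‖ ^ 2 ∂(harmonicMeasure w))
      ≤ 2 * (ENNReal.ofReal (1 - ‖w‖ ^ 2) * localEnergy w F) + ‖F w‖ₑ ^ 2 := by
  have hc0 : ContinuousOn F (sphere 0 1) := hF.continuousOn.mono sphere_subset_closedBall
  have hd : DifferentiableOn ℂ F (ball 0 1) := hF.differentiableOn.mono ball_subset_closedBall
  have hH := analyticOnNhd_comp_moebius hF hw
  have hHd : DifferentiableOn ℂ (F ∘ moebius w) (ball 0 1) := differentiableOn_comp_moebius hd hw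
  have hlim : ENNReal.ofReal (Real.circleAverage (fun z => ‖(F ∘ moebius w) z‖ ^ 2) 0 1)
      ≤ hardyEnergy (F ∘ moebius w) := by
    have hc1 : ContinuousOn (fun z => ‖(F ∘ moebius w) z‖ ^ 2) {z : ℂ | ‖z - 0‖ ∈ Icc (0 : ℝ) 1} :=
      (hH.continuousOn.norm.pow 2).mono fun z hz => by simpa using hz.2
    have hc2 := (Real.ContinuousOn.circleAverage hc1 fun r hr => hr.1) 1
      (right_mem_Icc.2 zero_le_one)
    have hc3 := (hc2.mono Ioo_subset_Icc_self).tendsto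
    rw [nhdsWithin_Ioo_eq_nhdsLT zero_lt_one] at hc3
    refine le_of_tendsto ((ENNReal.continuous_ofReal.tendsto _).comp hc3) ?_
    filter_upwards [Ioo_mem_nhdsLT (zero_lt_one : (0 : ℝ) < 1)] with r hr
    exact ofReal_circleAverage_sq_le_hardyEnergy hHd hr.1.le hr.2
  have h1 := hardyEnergy_le_two_mul_bergmanEnergy_add hHd
  rw [bergmanEnergy_comp_moebius hd hw, Function.comp_apply, moebius_zero] at h1
  refine le_trans (le_trans (le_of_eq ?_) hlim) h1
  rw [integral_harmonicMeasure_eq_circleAverage_comp_moebius (u := fun z => ‖F z‖ ^ 2) hw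
    (by fun_prop)]
  rfl

/-- The defect in Jensen's inequality for the truncation of `|F|² + ε²` at height `1` is
controlled by the local Dirichlet integral of `F`. -/
theorem ofReal_integral_min_le {F : ℂ → ℂ} (hF : AnalyticOnNhd ℂ F (closedBall 0 1))
    {ε : ℝ} (hε : 0 < ε) {w : ℂ} (hw : ‖w‖ < 1) :
    ENNReal.ofReal (∫ θ, min (‖F (circleMap 0 1 θ)‖ ^ 2 + ε ^ 2) 1 ∂(harmonicMeasure w))
      ≤ 2 * (ENNReal.ofReal (1 - ‖w‖ ^ 2) * localEnergy w F) + ENNReal.ofReal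
        (Real.exp (∫ θ, Real.log (min (‖F (circleMap 0 1 θ)‖ ^ 2 + ε ^ 2) 1)
          ∂(harmonicMeasure w))) := by
  have := isProbabilityMeasure_harmonicMeasure hw
  have hcF : Continuous fun θ : ℝ => F (circleMap 0 1 θ) :=
    (hF.continuousOn.mono sphere_subset_closedBall).comp_continuous (by fun_prop) fun θ => by simp
  obtain ⟨C, hC⟩ : ∃ C, ∀ θ : ℝ, ‖F (circleMap 0 1 θ)‖ ≤ C := by
    obtain ⟨C, hC⟩ := (isCompact_sphere (0 : ℂ) 1).exists_bound_of_continuousOn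
      (hF.continuousOn.mono sphere_subset_closedBall)
    exact ⟨C, fun θ => hC _ (by simp)⟩
  have h1 := integral_min_one_sub_exp_le (ν := harmonicMeasure w)
    (X := fun θ => ‖F (circleMap 0 1 θ)‖ ^ 2 + ε ^ 2)
    ((hcF.norm.pow 2).add continuous_const).measurable (δ := ε ^ 2)
    (C := C ^ 2 + ε ^ 2) (by positivity) (fun θ => le_add_of_nonneg_left (by positivity))
    (fun θ => by gcongr; exact hC θ)
  have h2 := norm_sq_add_le_exp_integral_log hF hε hw
  have h3 : ∫ θ, (‖F (circleMap 0 1 θ)‖ ^ 2 + ε ^ 2) ∂(harmonicMeasure w)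
      = ∫ θ, ‖F (circleMap 0 1 θ)‖ ^ 2 ∂(harmonicMeasure w) + ε ^ 2 := by
    rw [integral_add _ (integrable_const _)]
    · simp
    · refine integrable_harmonicMeasure (C := C ^ 2) hw (hcF.norm.pow 2).measurable fun θ => ?_
      rw [abs_of_nonneg (by positivity)]
      gcongr
      exact hC θ
  have h4 := ofReal_integral_norm_sq_le hF hw
  rw [h3] at h1
  have h5 : ∫ θ, min (‖F (circleMap 0 1 θ)‖ ^ 2 + ε ^ 2) 1 ∂(harmonicMeasure w) + ‖F w‖ ^ 2
      ≤ ∫ θ, ‖F (circleMap 0 1 θ)‖ ^ 2 ∂(harmonicMeasure w) +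
        Real.exp (∫ θ, Real.log (min (‖F (circleMap 0 1 θ)‖ ^ 2 + ε ^ 2) 1)
          ∂(harmonicMeasure w)) := by linarith
  have h6 := ENNReal.ofReal_le_ofReal h5
  rw [ENNReal.ofReal_add (integral_nonneg fun θ => by positivity) (by positivity),
    ENNReal.ofReal_add (integral_nonneg fun θ => by positivity) (by positivity),
    ENNReal.ofReal_pow (norm_nonneg _), ofReal_norm] at h6
  rw [← ENNReal.add_le_add_iff_right (a := ‖F w‖ₑ ^ 2) (by finiteness)]
  refine h6.trans ?_
  rw [add_right_comm]
  gcongr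

/-! ### Dilations and boundary values -/

theorem analyticOnNhd_dilation {f : ℂ → ℂ} (hf : DifferentiableOn ℂ f (ball 0 1)) {r : ℝ}
    (hr0 : 0 < r) (hr1 : r < 1) : AnalyticOnNhd ℂ (fun z => f (r * z)) (closedBall 0 1) := by
  intro z hz
  have hz1 : ‖z‖ ≤ 1 := by simpa using hz
  have hrz : (r : ℂ) * z ∈ ball (0 : ℂ) 1 := by
    simp only [mem_ball_zero_iff, norm_mul, Complex.norm_of_nonneg hr0.le]
    nlinarith [norm_nonneg z]
  exact (hf.analyticAt (isOpen_ball.mem_nhds hrz)).comp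
    (f := fun z => (r : ℂ) * z) (analyticAt_const.mul analyticAt_id)

theorem norm_one_sub_conj_mul_le_two_mul {w z : ℂ} (hz : ‖z‖ ≤ 1) {r : ℝ} (hr1 : r ≤ 1)
    (hr : 1 - r ≤ ‖1 - conj w * z‖) (hw : ‖w‖ ≤ 1) :
    ‖1 - conj w * (r * z)‖ ≤ 2 * ‖1 - conj w * z‖ := by
  have h1 : 1 - conj w * (r * z) = (1 - conj w * z) + (1 - r : ℝ) * (conj w * z) := by
    push_cast
    ring
  have h2 : ‖conj w * z‖ ≤ 1 := by
    rw [norm_mul, RCLike.norm_conj]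
    exact mul_le_one₀ hw (norm_nonneg _) hz
  rw [h1]
  refine (norm_add_le _ _).trans ?_
  rw [norm_mul, Complex.norm_of_nonneg (by linarith)]
  nlinarith [norm_nonneg (conj w * z)]

/-- Dilations of ratio close to `1` increase the local Dirichlet integral at `w` at most by a
factor `4`. -/
theorem localEnergy_dilation_le {f : ℂ → ℂ} (hf : DifferentiableOn ℂ f (ball 0 1)) {r : ℝ}
    (hr0 : 0 < r) (hr1 : r < 1) {w : ℂ} (hw : ‖w‖ ≤ r) :
    localEnergy w (fun z => f (r * z)) ≤ 4 * localEnergy w f := by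
  set k : ℂ → ℝ≥0∞ := fun u =>
    ‖deriv f u‖ₑ ^ 2 * (4 * ENNReal.ofReal ((1 - ‖u‖ ^ 2) / ‖1 - conj w * u‖ ^ 2)) with hk
  have hφ : ∀ z ∈ ball (0 : ℂ) 1, HasDerivAt (fun z : ℂ => (r : ℂ) * z) (r : ℂ) z := fun z _ => by
    simpa using (hasDerivAt_id z).const_mul (r : ℂ)
  have hr0' : (r : ℂ) ≠ 0 := by exact_mod_cast hr0.ne'
  have hinj : InjOn (fun z : ℂ => (r : ℂ) * z) (ball 0 1) := fun x _ y _ h =>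
    mul_left_cancel₀ hr0' h
  have himg : (fun z : ℂ => (r : ℂ) * z) '' ball 0 1 ⊆ ball 0 1 := by
    rintro _ ⟨z, hz, rfl⟩
    have : ‖z‖ < 1 := by simpa using hz
    simp only [mem_ball_zero_iff, norm_mul, Complex.norm_of_nonneg hr0.le]
    nlinarith [norm_nonneg z]
  have h1 := lintegral_image_eq_lintegral_enorm_deriv_sq_mul measurableSet_ball hφ hinj k
  have h2 : ∫⁻ z in ball (0 : ℂ) 1, ‖deriv (fun z => f (r * z)) z‖ₑ ^ 2 *
      ENNReal.ofReal ((1 - ‖z‖ ^ 2) / ‖1 - conj w * z‖ ^ 2)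
      ≤ ∫⁻ z in ball (0 : ℂ) 1, ‖(r : ℂ)‖ₑ ^ 2 * k (r * z) := by
    refine setLIntegral_mono' measurableSet_ball fun z hz => ?_
    have hz1 : ‖z‖ < 1 := by simpa using hz
    have hrz : (r : ℂ) * z ∈ ball (0 : ℂ) 1 := himg ⟨z, hz, rfl⟩
    have hd : deriv (fun z => f (r * z)) z = deriv f (r * z) * r :=
      ((hf.differentiableAt (isOpen_ball.mem_nhds hrz)).hasDerivAt.comp z (hφ z hz)).deriv
    rw [hd, enorm_mul, mul_pow, hk]
    simp only
    rw [mul_comm (‖deriv f (r * z)‖ₑ ^ 2), mul_assoc]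
    gcongr
    rw [show (4 : ℝ≥0∞) = ENNReal.ofReal 4 by simp, ← ENNReal.ofReal_mul (by norm_num)]
    refine ENNReal.ofReal_le_ofReal ?_
    have ha : 0 < ‖1 - conj w * z‖ := norm_pos_iff.2 (one_sub_conj_mul_ne_zero' (by linarith) hz1)
    have hb : 0 < ‖1 - conj w * (r * z)‖ :=
      norm_pos_iff.2 (one_sub_conj_mul_ne_zero' (by linarith) (by simpa using hrz))
    have hge : 1 - r ≤ ‖1 - conj w * z‖ := by
      have h3 := norm_sub_norm_le (1 : ℂ) (conj w * z)
      rw [norm_one, norm_mul, RCLike.norm_conj] at h3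
      nlinarith [norm_nonneg w, norm_nonneg z]
    have h4 := norm_one_sub_conj_mul_le_two_mul hz1.le hr1.le hge (by linarith)
    have h5 : ‖(r : ℂ) * z‖ ≤ ‖z‖ := by
      rw [norm_mul, Complex.norm_of_nonneg hr0.le]
      nlinarith [norm_nonneg z]
    have h6 : ‖(r : ℂ) * z‖ ^ 2 ≤ ‖z‖ ^ 2 := by gcongr
    have h7 : 0 ≤ 1 - ‖z‖ ^ 2 := by nlinarith [norm_nonneg z]
    rw [mul_div_assoc', div_le_div_iff₀ (by positivity) (by positivity)]
    calc (1 - ‖z‖ ^ 2) * ‖1 - conj w * (r * z)‖ ^ 2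
        ≤ (1 - ‖(r : ℂ) * z‖ ^ 2) * (2 * ‖1 - conj w * z‖) ^ 2 := by gcongr; linarith
      _ = _ := by ring
  have h3 : ∫⁻ u in ball (0 : ℂ) 1, k u = 4 * ∫⁻ z in ball (0 : ℂ) 1,
      ‖deriv f z‖ₑ ^ 2 * ENNReal.ofReal ((1 - ‖z‖ ^ 2) / ‖1 - conj w * z‖ ^ 2) := by
    rw [← lintegral_const_mul' _ _ (by simp)]
    congr 1
    ext u
    simp only [hk]
    ring
  rw [localEnergy, localEnergy, mul_left_comm, ← h3]
  exact mul_le_mul' le_rfl (h2.trans (h1 ▸ lintegral_mono_set himg))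

theorem tendsto_tsum_sq_mul_one_sub_pow_sq {a : ℕ → ℂ} (ha : Summable fun k => ‖a k‖ ^ 2) :
    Tendsto (fun r : ℝ => ∑' k, ‖a k‖ ^ 2 * (1 - r ^ k) ^ 2) (𝓝[<] 1) (𝓝 0) := by
  have h := tendsto_tsum_of_dominated_convergence (𝓕 := 𝓝[<] (1 : ℝ))
    (f := fun r k => ‖a k‖ ^ 2 * (1 - r ^ k) ^ 2) (g := fun _ => 0) ha (fun k => ?_) ?_
  · simpa using h
  · have : Continuous fun r : ℝ => ‖a k‖ ^ 2 * (1 - r ^ k) ^ 2 := by fun_prop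
    simpa using (this.tendsto 1).mono_left nhdsWithin_le_nhds
  · filter_upwards [Ioo_mem_nhdsLT (zero_lt_one : (0 : ℝ) < 1)] with r hr k
    have h0 : 0 ≤ r ^ k := by have := hr.1; positivity
    have h1 : r ^ k ≤ 1 := pow_le_one₀ hr.1.le hr.2.le
    rw [Real.norm_of_nonneg (by positivity)]
    exact mul_le_of_le_one_right (by positivity) (pow_le_one₀ (by linarith) (by linarith))

theorem summable_sq_of_hardyEnergy_lt_top {f : ℂ → ℂ} (h : hardyEnergy f < ∞) :
    Summable fun k => ‖taylorCoeff f k‖ ^ 2 := by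
  have h1 : ∑' k, ENNReal.ofReal (‖taylorCoeff f k‖ ^ 2) ≠ ∞ := by
    refine ne_of_lt (lt_of_eq_of_lt ?_ h)
    simp only [hardyEnergy, ENNReal.ofReal_pow (norm_nonneg _), ofReal_norm]
  have h2 := ENNReal.summable_toReal h1
  simpa [ENNReal.toReal_ofReal] using h2

theorem lintegral_enorm_sq_sub_circleMap_le {f : ℂ → ℂ} (hf : DifferentiableOn ℂ f (ball 0 1))
    (hfH : hardyEnergy f < ∞) {r s t : ℝ} (hr : 0 ≤ r) (hrs : r ≤ s) (hrt : r ≤ t) (hs : s < 1)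
    (ht : t < 1) :
    ∫⁻ θ in Ioc 0 (2 * Real.pi), ‖f (circleMap 0 s θ) - f (circleMap 0 t θ)‖ₑ ^ 2
      ≤ ENNReal.ofReal (2 * Real.pi * ∑' k, ‖taylorCoeff f k‖ ^ 2 * (1 - r ^ k) ^ 2) := by
  have hs0 := hr.trans hrs
  have ht0 := hr.trans hrt
  have hfs := continuous_comp_circleMap hf hs0 hs
  have hft := continuous_comp_circleMap hf ht0 ht
  have hbound : ∀ k, (s ^ k - t ^ k) ^ 2 ≤ (1 - r ^ k) ^ 2 := by
    intro k
    have h1 : r ^ k ≤ s ^ k := by gcongr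
    have h2 : r ^ k ≤ t ^ k := by gcongr
    have h3 : s ^ k ≤ 1 := pow_le_one₀ hs0 hs.le
    have h4 : t ^ k ≤ 1 := pow_le_one₀ ht0 ht.le
    exact sq_le_sq' (by linarith) (by linarith)
  have hP := hasSum_sq_circleAverage (b := fun k => taylorCoeff f k * ((s : ℂ) ^ k - (t : ℂ) ^ k))
    (F := fun z => f (s * z) - f (t * z)) ?_ ?_
  · have hnorm : ∀ k, ‖taylorCoeff f k * ((s : ℂ) ^ k - (t : ℂ) ^ k)‖ ^ 2
        = ‖taylorCoeff f k‖ ^ 2 * (s ^ k - t ^ k) ^ 2 := by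
      intro k
      rw [norm_mul, mul_pow]
      congr 1
      have : (s : ℂ) ^ k - (t : ℂ) ^ k = ((s ^ k - t ^ k : ℝ) : ℂ) := by push_cast; rfl
      rw [this, Complex.norm_real, Real.norm_eq_abs, sq_abs]
    simp_rw [hnorm] at hP
    have h1 : ∀ θ : ℝ, ‖f (circleMap 0 s θ) - f (circleMap 0 t θ)‖ₑ ^ 2
        = ENNReal.ofReal (‖f (circleMap 0 s θ) - f (circleMap 0 t θ)‖ ^ 2) := by
      intro θ
      rw [← ofReal_norm, ENNReal.ofReal_pow (norm_nonneg _)]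
    simp_rw [h1]
    rw [← ofReal_integral_eq_lintegral_ofReal,
      ← intervalIntegral.integral_of_le Real.two_pi_pos.le]
    · refine ENNReal.ofReal_le_ofReal ?_
      have h2 : ∫ θ in (0 : ℝ)..2 * Real.pi, ‖f (circleMap 0 s θ) - f (circleMap 0 t θ)‖ ^ 2
          = 2 * Real.pi * Real.circleAverage (fun z => ‖f (s * z) - f (t * z)‖ ^ 2) 0 1 := by
        rw [Real.circleAverage_def, smul_eq_mul, mul_inv_cancel_left₀ Real.two_pi_pos.ne']
        simp [circleMap]
      rw [h2, ← hP.tsum_eq]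
      refine mul_le_mul_of_nonneg_left (hP.summable.tsum_le_tsum (fun k => ?_) ?_)
        Real.two_pi_pos.le
      · exact mul_le_mul_of_nonneg_left (hbound k) (by positivity)
      · have h3 := summable_sq_of_hardyEnergy_lt_top hfH
        refine h3.of_nonneg_of_le (fun k => by positivity) fun k => ?_
        have h0 : 0 ≤ r ^ k := by positivity
        have h1 : r ^ k ≤ 1 := pow_le_one₀ hr (hrs.trans hs.le)
        exact mul_le_of_le_one_right (by positivity) (pow_le_one₀ (by linarith) (by linarith))
    · exact ((hfs.sub hft).norm.pow 2).integrableOn_Icc.mono_set Ioc_subset_Icc_self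
    · exact Eventually.of_forall fun θ => by positivity
  · have h1 := (summable_norm_taylorCoeff_mul_pow hf hs0 hs).add
      (summable_norm_taylorCoeff_mul_pow hf ht0 ht)
    refine h1.of_nonneg_of_le (fun k => norm_nonneg _) fun k => ?_
    rw [norm_mul, ← mul_add]
    gcongr
    refine (norm_sub_le _ _).trans (le_of_eq ?_)
    simp [abs_of_nonneg hs0, abs_of_nonneg ht0]
  · intro z hz
    have hz1 : ‖z‖ = 1 := by simpa using hz
    have h1 := (hasSum_taylorCoeff hf (z := s * z) (by simp [hz1, abs_of_nonneg hs0, hs])).sub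
      (hasSum_taylorCoeff hf (z := t * z) (by simp [hz1, abs_of_nonneg ht0, ht]))
    refine h1.congr_fun fun k => ?_
    rw [mul_pow, mul_pow]
    ring

/-- A function in the Hardy space converges almost everywhere along some sequence of concentric
circles. -/
theorem exists_seq_radii_ae_tendsto {f : ℂ → ℂ} (hf : DifferentiableOn ℂ f (ball 0 1))
    (hfH : hardyEnergy f < ∞) :
    ∃ r : ℕ → ℝ, (∀ n, r n ∈ Ioo (0 : ℝ) 1) ∧ Tendsto r atTop (𝓝[<] 1) ∧
      ∀ᵐ θ ∂(volume.restrict (Ioc 0 (2 * Real.pi))),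
        ∃ l : ℂ, Tendsto (fun n => f (circleMap 0 (r n) θ)) atTop (𝓝 l) := by
  obtain ⟨ρ, hρm, hρI, hρ⟩ := exists_seq_strictMono_tendsto' (zero_lt_one : (0 : ℝ) < 1)
  have hρ' : Tendsto ρ atTop (𝓝[<] 1) :=
    tendsto_nhdsWithin_iff.2 ⟨hρ, Eventually.of_forall fun n => (hρI n).2⟩
  have hlim := ((tendsto_tsum_sq_mul_one_sub_pow_sq
    (summable_sq_of_hardyEnergy_lt_top hfH)).const_mul (2 * Real.pi)).comp hρ'
  rw [mul_zero] at hlim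
  obtain ⟨φ, hφ, hφP⟩ := extraction_forall_of_eventually (P := fun n k =>
    2 * Real.pi * ∑' j, ‖taylorCoeff f j‖ ^ 2 * (1 - ρ k ^ j) ^ 2 < ((1 / 2 : ℝ) ^ n) ^ 2)
    fun n => hlim.eventually_lt_const (by positivity)
  refine ⟨ρ ∘ φ, fun n => hρI _, hρ'.comp hφ.tendsto_atTop, ?_⟩
  refine Lp.ae_tendsto_of_cauchy_eLpNorm (p := 2) (B := fun n => ENNReal.ofReal ((1 / 2) ^ n))
    (fun n => (continuous_comp_circleMap hf (hρI _).1.le (hρI _).2).aestronglyMeasurable)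
    (by norm_num) ?_ ?_
  · rw [← ENNReal.ofReal_tsum_of_nonneg (fun n => by positivity)
      (summable_geometric_of_lt_one (by norm_num) (by norm_num))]
    exact ENNReal.ofReal_ne_top
  · intro N n m hn hm
    have hmono := (hρm.comp hφ).monotone
    have h1 := lintegral_enorm_sq_sub_circleMap_le hf hfH (hρI (φ N)).1.le (hmono hn) (hmono hm)
      (hρI _).2 (hρI _).2
    have h2 : (eLpNorm ((fun θ => f (circleMap 0 ((ρ ∘ φ) n) θ)) -
        fun θ => f (circleMap 0 ((ρ ∘ φ) m) θ)) 2 (volume.restrict (Ioc 0 (2 * Real.pi)))) ^ 2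
        < (ENNReal.ofReal ((1 / 2) ^ N)) ^ 2 := by
      have h3 := eLpNorm_nnreal_pow_eq_lintegral (p := 2)
        (f := (fun θ => f (circleMap 0 ((ρ ∘ φ) n) θ)) - fun θ => f (circleMap 0 ((ρ ∘ φ) m) θ))
        (μ := volume.restrict (Ioc 0 (2 * Real.pi))) two_ne_zero
      simp only [NNReal.coe_ofNat, ENNReal.rpow_ofNat, ENNReal.coe_ofNat, Pi.sub_apply] at h3
      rw [h3]
      refine lt_of_le_of_lt h1 ?_
      rw [← ENNReal.ofReal_pow (by positivity)]
      exact (ENNReal.ofReal_lt_ofReal_iff (by positivity)).2 (hφP N)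
    exact not_le.1 fun h => absurd h2 (not_lt.2 (pow_le_pow_left' h 2))

/-! ### Truncation of the modulus of a Hardy space function -/

section
variable {f : ℂ → ℂ} {V : ℂ → ℝ} {C ε : ℝ} {r : ℕ → ℝ}

theorem tendsto_integral_truncation (hf : DifferentiableOn ℂ f (ball 0 1))
    (hε : 0 < ε) (hr : ∀ n, r n ∈ Ioo (0 : ℝ) 1)
    (hlim : ∀ᵐ θ ∂(volume.restrict (Ioc 0 (2 * Real.pi))),
      Tendsto (fun n => min (‖f (circleMap 0 (r n) θ)‖ ^ 2 + ε ^ 2) 1) atTop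
        (𝓝 (Real.exp (2 * V (circleMap 0 1 θ))))) {w : ℂ} (hw : ‖w‖ < 1) :
    Tendsto (fun n => ∫ θ, min (‖f (circleMap 0 (r n) θ)‖ ^ 2 + ε ^ 2) 1 ∂(harmonicMeasure w)) atTop
        (𝓝 (∫ θ, Real.exp (2 * V (circleMap 0 1 θ)) ∂(harmonicMeasure w))) ∧
      Tendsto (fun n => ∫ θ, Real.log (min (‖f (circleMap 0 (r n) θ)‖ ^ 2 + ε ^ 2) 1)
        ∂(harmonicMeasure w)) atTop
        (𝓝 (∫ θ, 2 * V (circleMap 0 1 θ) ∂(harmonicMeasure w))) := by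
  have := isProbabilityMeasure_harmonicMeasure hw
  have hlim' := (harmonicMeasure_absolutelyContinuous w).ae_le hlim
  have hc : ∀ n, Continuous fun θ : ℝ => min (‖f (circleMap 0 (r n) θ)‖ ^ 2 + ε ^ 2) 1 := fun n =>
    (((continuous_comp_circleMap hf (hr n).1.le (hr n).2).norm.pow 2).add
      continuous_const).min continuous_const
  have hlow : ∀ n θ, min (ε ^ 2) 1 ≤ min (‖f (circleMap 0 (r n) θ)‖ ^ 2 + ε ^ 2) 1 := fun n θ =>
    min_le_min_right _ (le_add_of_nonneg_left (by positivity))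
  have hpos : 0 < min (ε ^ 2) 1 := lt_min (by positivity) one_pos
  constructor
  · refine tendsto_integral_of_dominated_convergence (fun _ => 1)
      (fun n => (hc n).aestronglyMeasurable) (integrable_const _) (fun n => ?_) hlim'
    refine Eventually.of_forall fun θ => ?_
    rw [Real.norm_of_nonneg (hpos.le.trans (hlow n θ))]
    exact min_le_right _ _
  · refine tendsto_integral_of_dominated_convergence (fun _ => -Real.log (min (ε ^ 2) 1))
      (fun n => ((hc n).log fun θ => (hpos.trans_le (hlow n θ)).ne').aestronglyMeasurable)
      (integrable_const _) (fun n => ?_) ?_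
    · refine Eventually.of_forall fun θ => ?_
      rw [Real.norm_of_nonpos (Real.log_nonpos (hpos.le.trans (hlow n θ)) (min_le_right _ _)),
        neg_le_neg_iff]
      exact Real.log_le_log hpos (hlow n θ)
    · filter_upwards [hlim'] with θ hθ
      have := (Real.continuousAt_log (Real.exp_pos _).ne').tendsto.comp hθ
      rwa [Real.log_exp] at this

/-- The outer function whose modulus is the truncation of `(|f|² + ε²)^(1/2)` at height `1` has
local Dirichlet integrals controlled by those of `f`. -/
theorem localEnergy_outerFunction_le (hf : DifferentiableOn ℂ f (ball 0 1))
    (hε : 0 < ε) (hr : ∀ n, r n ∈ Ioo (0 : ℝ) 1) (hr1 : Tendsto r atTop (𝓝[<] 1))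
    (hV : Measurable fun θ => V (circleMap 0 1 θ)) (hC : ∀ θ, |V (circleMap 0 1 θ)| ≤ C)
    (hlim : ∀ᵐ θ ∂(volume.restrict (Ioc 0 (2 * Real.pi))),
      Tendsto (fun n => min (‖f (circleMap 0 (r n) θ)‖ ^ 2 + ε ^ 2) 1) atTop
        (𝓝 (Real.exp (2 * V (circleMap 0 1 θ))))) {w : ℂ} (hw : ‖w‖ < 1) :
    localEnergy w (outerFunction V) ≤ 8 * localEnergy w f := by
  obtain ⟨h1, h2⟩ := tendsto_integral_truncation hf hε hr hlim hw
  have hev : ∀ᶠ n in atTop, ‖w‖ ≤ r n := by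
    have := (hr1.mono_right nhdsWithin_le_nhds).eventually_const_lt hw
    exact this.mono fun n hn => hn.le
  have h3 : ∀ᶠ n in atTop, ENNReal.ofReal (∫ θ, min (‖f (circleMap 0 (r n) θ)‖ ^ 2 + ε ^ 2) 1
      ∂(harmonicMeasure w)) ≤ ENNReal.ofReal (1 - ‖w‖ ^ 2) * (8 * localEnergy w f) +
      ENNReal.ofReal (Real.exp (∫ θ, Real.log (min (‖f (circleMap 0 (r n) θ)‖ ^ 2 + ε ^ 2) 1)
        ∂(harmonicMeasure w))) := by
    filter_upwards [hev] with n hn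
    have h4 := ofReal_integral_min_le (analyticOnNhd_dilation hf (hr n).1 (hr n).2) hε hw
    have h5 : ∀ θ : ℝ, (r n : ℂ) * circleMap 0 1 θ = circleMap 0 (r n) θ := fun θ => by
      simp [circleMap]
    simp only [h5] at h4
    refine h4.trans (add_le_add_left ?_ _)
    rw [mul_left_comm, show (8 : ℝ≥0∞) = 2 * 4 by norm_num, mul_assoc]
    exact mul_le_mul' le_rfl (mul_le_mul' le_rfl
      (localEnergy_dilation_le hf (hr n).1 (hr n).2 hn))
  have h4 : ENNReal.ofReal (∫ θ, Real.exp (2 * V (circleMap 0 1 θ)) ∂(harmonicMeasure w))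
      ≤ ENNReal.ofReal (1 - ‖w‖ ^ 2) * (8 * localEnergy w f) +
        ENNReal.ofReal (Real.exp (∫ θ, 2 * V (circleMap 0 1 θ) ∂(harmonicMeasure w))) :=
    le_of_tendsto_of_tendsto ((ENNReal.continuous_ofReal.tendsto _).comp h1)
      (((ENNReal.continuous_ofReal.comp Real.continuous_exp).tendsto _).comp h2 |>.const_add _) h3
  have h5 := (localEnergy_outerFunction_add_le hV hC hw).trans h4
  have hpos : 0 < 1 - ‖w‖ ^ 2 := by nlinarith [norm_nonneg w]
  rw [ENNReal.add_le_add_iff_right ENNReal.ofReal_ne_top] at h5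
  exact (ENNReal.mul_le_mul_iff_right (by simpa using hpos) ENNReal.ofReal_ne_top).1 h5

theorem hardyEnergy_outerFunction_le (hf : DifferentiableOn ℂ f (ball 0 1))
    (hε : 0 < ε) (hr : ∀ n, r n ∈ Ioo (0 : ℝ) 1)
    (hV : Measurable fun θ => V (circleMap 0 1 θ)) (hC : ∀ θ, |V (circleMap 0 1 θ)| ≤ C)
    (hlim : ∀ᵐ θ ∂(volume.restrict (Ioc 0 (2 * Real.pi))),
      Tendsto (fun n => min (‖f (circleMap 0 (r n) θ)‖ ^ 2 + ε ^ 2) 1) atTop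
        (𝓝 (Real.exp (2 * V (circleMap 0 1 θ))))) :
    hardyEnergy (outerFunction V) ≤ hardyEnergy f + ENNReal.ofReal (ε ^ 2) := by
  have h0 : ‖(0 : ℂ)‖ < 1 := by simp
  have := isProbabilityMeasure_harmonicMeasure h0
  obtain ⟨h1, -⟩ := tendsto_integral_truncation hf hε hr hlim h0
  have hVe : Measurable fun θ => Real.exp (2 * V (circleMap 0 1 θ)) :=
    Real.measurable_exp.comp (hV.const_mul 2)
  have hint := circleIntegrable_of_bounded (V := fun ζ => Real.exp (2 * V ζ)) hVe
    (abs_exp_two_mul_le hC)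
  have h2 := hardyEnergy_le_of_majorant
    (differentiableOn_outerFunction (circleIntegrable_of_bounded hV hC))
    (differentiableOn_herglotzIntegral hint)
    fun z hz => norm_outerFunction_sq_le hV hC (by simpa using hz)
  rw [re_herglotzIntegral hint h0] at h2
  refine h2.trans (le_of_tendsto ((ENNReal.continuous_ofReal.tendsto _).comp h1)
    (Eventually.of_forall fun n => ?_))
  have hcn := continuous_comp_circleMap hf (hr n).1.le (hr n).2
  have hcn2 : Continuous fun θ : ℝ => ‖f (circleMap 0 (r n) θ)‖ ^ 2 := hcn.norm.pow 2
  obtain ⟨M, hM⟩ : ∃ M, ∀ θ : ℝ, ‖f (circleMap 0 (r n) θ)‖ ^ 2 ≤ M := by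
    have hsub : sphere (0 : ℂ) (r n) ⊆ ball 0 1 :=
      sphere_subset_closedBall.trans (closedBall_subset_ball (hr n).2)
    obtain ⟨M, hM⟩ := (isCompact_sphere (0 : ℂ) (r n)).exists_bound_of_continuousOn
      (hf.continuousOn.mono hsub)
    refine ⟨M ^ 2, fun θ => ?_⟩
    gcongr
    exact hM _ (circleMap_mem_sphere _ (hr n).1.le _)
  have hi : Integrable (fun θ : ℝ => ‖f (circleMap 0 (r n) θ)‖ ^ 2) (harmonicMeasure 0) :=
    integrable_harmonicMeasure (C := M) h0 hcn2.measurable fun θ => by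
      rw [abs_of_nonneg (by positivity)]
      exact hM θ
  have h3 : ∫ θ, ‖f (circleMap 0 (r n) θ)‖ ^ 2 ∂(harmonicMeasure 0)
      = Real.circleAverage (fun z => ‖f z‖ ^ 2) 0 (r n) := by
    have h4 := integral_harmonicMeasure h0 fun z => ‖f (r n * z)‖ ^ 2
    have h5 : ∀ θ : ℝ, (r n : ℂ) * circleMap 0 1 θ = circleMap 0 (r n) θ := fun θ => by
      simp [circleMap]
    simp only [h5] at h4
    rw [h4, Real.circleAverage_eq_circleAverage_zero_one (f := fun z => ‖f z‖ ^ 2) (R := r n)]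
    refine Real.circleAverage_congr_sphere fun z hz => ?_
    have hz1 : ‖z‖ = 1 := by simpa using hz
    simp [poissonKernel, hz1]
  have h4 : ∫ θ, min (‖f (circleMap 0 (r n) θ)‖ ^ 2 + ε ^ 2) 1 ∂(harmonicMeasure 0)
      ≤ Real.circleAverage (fun z => ‖f z‖ ^ 2) 0 (r n) + ε ^ 2 := by
    rw [← h3]
    calc ∫ θ, min (‖f (circleMap 0 (r n) θ)‖ ^ 2 + ε ^ 2) 1 ∂(harmonicMeasure 0)
        ≤ ∫ θ, (‖f (circleMap 0 (r n) θ)‖ ^ 2 + ε ^ 2) ∂(harmonicMeasure 0) := by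
          refine integral_mono_of_nonneg (Eventually.of_forall fun θ => ?_)
            (hi.add (integrable_const _)) (Eventually.of_forall fun θ => min_le_left _ _)
          simp only [Pi.zero_apply]
          positivity
      _ = _ := by
          rw [integral_add hi (integrable_const _)]
          simp
  refine (ENNReal.ofReal_le_ofReal h4).trans (ENNReal.ofReal_add_le.trans ?_)
  gcongr
  exact ofReal_circleAverage_sq_le_hardyEnergy hf (hr n).1.le (hr n).2

end

/-- A Hardy space function `f` has, for every `ε > 0`, a bounded truncated logarithm: `V` with
`exp (2 V)` equal almost everywhere to `min (|f|² + ε², 1)`, where `|f|²` is the limit along a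
sequence of concentric circles. -/
theorem exists_truncated_log {f : ℂ → ℂ} (hf : DifferentiableOn ℂ f (ball 0 1))
    (hfH : hardyEnergy f < ∞) {ε : ℝ} (hε : 0 < ε) :
    ∃ (V : ℂ → ℝ) (C : ℝ) (r : ℕ → ℝ), (∀ n, r n ∈ Ioo (0 : ℝ) 1) ∧ Tendsto r atTop (𝓝[<] 1) ∧
      (Measurable fun θ => V (circleMap 0 1 θ)) ∧ (∀ θ, |V (circleMap 0 1 θ)| ≤ C) ∧
      ∀ᵐ θ ∂(volume.restrict (Ioc 0 (2 * Real.pi))),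
        Tendsto (fun n => min (‖f (circleMap 0 (r n) θ)‖ ^ 2 + ε ^ 2) 1) atTop
          (𝓝 (Real.exp (2 * V (circleMap 0 1 θ)))) := by
  obtain ⟨r, hr, hr1, hae⟩ := exists_seq_radii_ae_tendsto hf hfH
  set L : ℂ → ℝ := fun ζ => limsup (fun n => ‖f (r n * ζ)‖ ^ 2) atTop with hL
  set m : ℂ → ℝ := fun ζ => min (max (L ζ) 0 + ε ^ 2) 1 with hm
  have hmul : ∀ n (θ : ℝ), (r n : ℂ) * circleMap 0 1 θ = circleMap 0 (r n) θ := fun n θ => by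
    simp [circleMap]
  have hLm : Measurable fun θ => L (circleMap 0 1 θ) := by
    simp only [hL, hmul]
    exact Measurable.limsup fun n =>
      ((continuous_comp_circleMap hf (hr n).1.le (hr n).2).norm.pow 2).measurable
  have hpos : 0 < min (ε ^ 2) 1 := lt_min (by positivity) one_pos
  have hlow : ∀ ζ, min (ε ^ 2) 1 ≤ m ζ := fun ζ =>
    min_le_min_right _ (le_add_of_nonneg_left (le_max_right _ _))
  have hm1 : ∀ ζ, m ζ ≤ 1 := fun ζ => min_le_right _ _
  refine ⟨fun ζ => 2⁻¹ * Real.log (m ζ), 2⁻¹ * -Real.log (min (ε ^ 2) 1), r, hr, hr1, ?_, ?_, ?_⟩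
  · exact (Real.measurable_log.comp (((hLm.max measurable_const).add_const _).min
      measurable_const)).const_mul _
  · intro θ
    rw [abs_mul, abs_of_pos (by norm_num : (0 : ℝ) < 2⁻¹),
      abs_of_nonpos (Real.log_nonpos (hpos.le.trans (hlow _)) (hm1 _))]
    gcongr
    exact hlow _
  · filter_upwards [hae] with θ ⟨l, hl⟩
    have h1 : Tendsto (fun n => ‖f (circleMap 0 (r n) θ)‖ ^ 2) atTop (𝓝 (‖l‖ ^ 2)) :=
      hl.norm.pow 2
    have h2 : L (circleMap 0 1 θ) = ‖l‖ ^ 2 := by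
      simp only [hL, hmul]
      exact h1.limsup_eq
    have h3 : Real.exp (2 * (2⁻¹ * Real.log (m (circleMap 0 1 θ)))) = min (‖l‖ ^ 2 + ε ^ 2) 1 := by
      rw [mul_inv_cancel_left₀ two_ne_zero, Real.exp_log (hpos.trans_le (hlow _))]
      simp only [hm, h2, max_eq_left (sq_nonneg ‖l‖)]
    rw [h3]
    exact (h1.add_const _).min tendsto_const_nhds

/-! ### Weighted Dirichlet integrals -/

theorem enorm_deriv_sq_mul_localWeight_measurable (f : ℂ → ℂ) (w : ℂ) :
    Measurable fun z => ‖deriv f z‖ₑ ^ 2 *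
      ENNReal.ofReal ((1 - ‖z‖ ^ 2) / ‖1 - conj w * z‖ ^ 2) := by
  have := measurable_deriv f
  fun_prop

/-- On the radius to `ζ`, the weights are at most `4` times the Poisson kernel at `ζ`. -/
theorem localEnergy_radial_le {f : ℂ → ℂ} {ζ : ℂ} (hζ : ‖ζ‖ = 1) {ρ : ℝ} (hρ0 : 0 < ρ)
    (hρ1 : ρ < 1) : localEnergy (ρ * ζ) f ≤ 4 * localEnergy ζ f := by
  have key : ∫⁻ z in ball (0 : ℂ) 1, ‖deriv f z‖ₑ ^ 2 *
      ENNReal.ofReal ((1 - ‖z‖ ^ 2) / ‖1 - conj (ρ * ζ) * z‖ ^ 2)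
      ≤ 4 * ∫⁻ z in ball (0 : ℂ) 1, ‖deriv f z‖ₑ ^ 2 *
        ENNReal.ofReal ((1 - ‖z‖ ^ 2) / ‖1 - conj ζ * z‖ ^ 2) := by
    rw [← lintegral_const_mul' _ _ (by simp)]
    refine setLIntegral_mono' measurableSet_ball fun z hz => ?_
    have hz1 : ‖z‖ < 1 := by simpa using hz
    rw [mul_left_comm]
    gcongr
    rw [show (4 : ℝ≥0∞) = ENNReal.ofReal 4 by simp, ← ENNReal.ofReal_mul (by norm_num)]
    refine ENNReal.ofReal_le_ofReal ?_
    have hρζ : ‖(ρ : ℂ) * ζ‖ < 1 := by simpa [hζ, abs_of_pos hρ0] using hρ1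
    have ha : 0 < ‖1 - conj ζ * z‖ := norm_pos_iff.2 (one_sub_conj_mul_ne_zero' hζ.le hz1)
    have hb : 0 < ‖1 - conj (ρ * ζ) * z‖ := norm_pos_iff.2 (one_sub_conj_mul_ne_zero hρζ hz1.le)
    have h1 : 1 - conj ζ * z = (1 - conj (ρ * ζ) * z) - (1 - ρ : ℝ) * (conj ζ * z) := by
      simp
      ring
    have h2 : ‖conj ζ * z‖ ≤ 1 := by
      rw [norm_mul, RCLike.norm_conj, hζ, one_mul]
      exact hz1.le
    have h3 : 1 - ρ ≤ ‖1 - conj (ρ * ζ) * z‖ := by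
      have h4 := norm_sub_norm_le (1 : ℂ) (conj (ρ * ζ) * z)
      rw [norm_one, norm_mul, RCLike.norm_conj, norm_mul, hζ, Complex.norm_of_nonneg hρ0.le] at h4
      nlinarith [norm_nonneg z]
    have h4 : ‖1 - conj ζ * z‖ ≤ 2 * ‖1 - conj (ρ * ζ) * z‖ := by
      rw [h1]
      refine (norm_sub_le _ _).trans ?_
      rw [norm_mul ((1 - ρ : ℝ) : ℂ), Complex.norm_of_nonneg (by linarith)]
      nlinarith [norm_nonneg (conj ζ * z)]
    have h7 : 0 ≤ 1 - ‖z‖ ^ 2 := by nlinarith [norm_nonneg z]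
    rw [mul_div_assoc', div_le_div_iff₀ (by positivity) (by positivity)]
    calc (1 - ‖z‖ ^ 2) * ‖1 - conj ζ * z‖ ^ 2
        ≤ (1 - ‖z‖ ^ 2) * (2 * ‖1 - conj (ρ * ζ) * z‖) ^ 2 := by gcongr
      _ = _ := by ring
  rw [localEnergy, localEnergy, mul_left_comm]
  exact mul_le_mul' le_rfl key

/-- Fatou's lemma for the local weights along the radius to `ζ`. -/
theorem localEnergy_le_liminf (g : ℂ → ℂ) {ζ : ℂ} (hζ : ‖ζ‖ = 1) :
    localEnergy ζ g ≤ liminf (fun ρ : ℝ => localEnergy (ρ * ζ) g) (𝓝[<] 1) := by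
  have h1 : ∫⁻ z in ball (0 : ℂ) 1, ‖deriv g z‖ₑ ^ 2 *
      ENNReal.ofReal ((1 - ‖z‖ ^ 2) / ‖1 - conj ζ * z‖ ^ 2)
      ≤ liminf (fun ρ : ℝ => ∫⁻ z in ball (0 : ℂ) 1, ‖deriv g z‖ₑ ^ 2 *
        ENNReal.ofReal ((1 - ‖z‖ ^ 2) / ‖1 - conj (ρ * ζ) * z‖ ^ 2)) (𝓝[<] 1) := by
    refine le_trans (le_of_eq (setLIntegral_congr_fun measurableSet_ball fun z hz => ?_))
      (lintegral_liminf_le fun ρ : ℝ => enorm_deriv_sq_mul_localWeight_measurable g (ρ * ζ))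
    have hz1 : ‖z‖ < 1 := by simpa using hz
    have ha : 0 < ‖1 - conj ζ * z‖ := norm_pos_iff.2 (one_sub_conj_mul_ne_zero' hζ.le hz1)
    refine (Tendsto.liminf_eq ?_).symm
    refine ENNReal.Tendsto.const_mul ?_ (Or.inr (by finiteness))
    refine (ENNReal.continuous_ofReal.tendsto _).comp ?_
    refine Tendsto.div tendsto_const_nhds ?_ (by positivity)
    have : Continuous fun ρ : ℝ => ‖1 - conj ((ρ : ℂ) * ζ) * z‖ ^ 2 := by fun_prop
    simpa using (this.tendsto 1).mono_left nhdsWithin_le_nhds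
  simp only [localEnergy]
  rw [ENNReal.liminf_const_mul_of_ne_top ENNReal.ofReal_ne_top]
  exact mul_le_mul' le_rfl h1

/-- A comparison of local Dirichlet integrals at interior points passes to boundary points. -/
theorem localEnergy_boundary_le {f g : ℂ → ℂ} {c : ℝ≥0∞}
    (h : ∀ w : ℂ, ‖w‖ < 1 → localEnergy w g ≤ c * localEnergy w f) {ζ : ℂ} (hζ : ‖ζ‖ = 1) :
    localEnergy ζ g ≤ c * (4 * localEnergy ζ f) := by
  refine (localEnergy_le_liminf g hζ).trans ?_
  refine liminf_le_of_frequently_le' (Eventually.frequently ?_)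
  filter_upwards [Ioo_mem_nhdsLT (zero_lt_one : (0 : ℝ) < 1)] with ρ hρ
  refine (h _ (by simpa [hζ, abs_of_pos hρ.1] using hρ.2)).trans ?_
  gcongr
  exact localEnergy_radial_le hζ hρ.1 hρ.2

theorem norm_coe_circle_sub (ζ : Circle) (z : ℂ) : ‖z - (ζ : ℂ)‖ = ‖1 - conj (ζ : ℂ) * z‖ := by
  have h : 1 - conj (ζ : ℂ) * z = -(conj (ζ : ℂ) * (z - ζ)) := by
    rw [mul_sub, Complex.conj_mul', Circle.norm_coe]
    simp
  rw [h, norm_neg, norm_mul, RCLike.norm_conj, Circle.norm_coe, one_mul]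

/-- The weighted Dirichlet integral is the average of the local Dirichlet integrals. -/
theorem dirichletIntegral_eq_lintegral_localEnergy (μ : Measure Circle) [IsFiniteMeasure μ]
    (f : 𝔻 → ℂ) : dirichletIntegral μ f = ∫⁻ ζ : Circle, localEnergy ζ (discExt f) ∂μ := by
  have hder := measurable_deriv (discExt f)
  have hm : Measurable fun p : ℂ × Circle => ‖deriv (discExt f) p.1‖ₑ ^ 2 *
      ENNReal.ofReal ((1 - ‖p.1‖ ^ 2) / ‖1 - conj (p.2 : ℂ) * p.1‖ ^ 2) := by
    have hcoe : Measurable fun ζ : Circle => (ζ : ℂ) := Continuous.measurable (by fun_prop)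
    have h1 : Measurable fun p : ℂ × Circle => ‖1 - conj (p.2 : ℂ) * p.1‖ ^ 2 :=
      (((Complex.continuous_conj.measurable.comp (hcoe.comp measurable_snd)).mul
        measurable_fst).const_sub 1).norm.pow_const 2
    exact ((hder.comp measurable_fst).enorm.pow_const 2).mul
      (((measurable_fst.norm.pow_const 2).const_sub 1).div h1).ennreal_ofReal
  simp only [dirichletIntegral, localEnergy]
  rw [lintegral_const_mul' _ _ ENNReal.ofReal_ne_top,
    ← lintegral_lintegral_swap hm.aemeasurable]
  congr 2
  ext z
  rw [poissonIntegral, ← lintegral_const_mul' _ _ (by finiteness)]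
  simp only [norm_coe_circle_sub]

/-! ### Boundary modulus of outer functions -/

theorem re_herglotzRieszKernel_circle {ζ z : ℂ} (hζ : ‖ζ‖ = 1) (hz : ‖z‖ = 1) :
    (herglotzRieszKernel 0 ζ z).re = 0 := by
  have h := congrFun (poissonKernel_eq_re_herglotzRieszKernel (c := 0) (w := ζ)) z
  rw [Function.comp_apply] at h
  rw [← h]
  simp [poissonKernel, hζ, hz]

/-- If `V` vanishes on a neighbourhood of `exp (i θ₀)`, the outer function with boundary modulus
`exp V` has a unimodular radial limit there: the Herglotz integral converges by dominated
convergence, and the Herglotz kernel is purely imaginary on the circle. -/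
theorem exists_tendsto_outerFunction_norm_eq_one {V : ℂ → ℝ} {C : ℝ}
    (hV : Measurable fun θ => V (circleMap 0 1 θ)) (hC : ∀ θ, |V (circleMap 0 1 θ)| ≤ C)
    {U : Set Circle} (hU : IsOpen U)
    (hVU : ∀ᵐ θ ∂(volume.restrict (Ioc 0 (2 * Real.pi))),
      Circle.exp θ ∈ U → V (circleMap 0 1 θ) = 0) {θ₀ : ℝ} (hθ₀ : Circle.exp θ₀ ∈ U) :
    ∃ w : ℂ, Tendsto (fun r : ℝ => outerFunction V (r * (Circle.exp θ₀ : ℂ))) (𝓝[<] 1) (𝓝 w) ∧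
      ‖w‖ = 1 := by
  set ζ : ℂ := (Circle.exp θ₀ : ℂ) with hζ
  have hζ1 : ‖ζ‖ = 1 := by simp [hζ]
  have hC0 : 0 ≤ C := (abs_nonneg _).trans (hC 0)
  obtain ⟨δ, hδ, hball⟩ := Metric.isOpen_iff.1 hU _ hθ₀
  have hexp : ∀ θ : ℝ, (Circle.exp θ : ℂ) = circleMap 0 1 θ := fun θ => by simp [circleMap]
  have hfar : ∀ᵐ θ ∂(volume.restrict (Ioc 0 (2 * Real.pi))),
      V (circleMap 0 1 θ) = 0 ∨ δ ≤ ‖circleMap 0 1 θ - ζ‖ := by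
    filter_upwards [hVU] with θ hθ
    by_cases h : Circle.exp θ ∈ U
    · exact Or.inl (hθ h)
    · refine Or.inr (not_lt.1 fun hlt => h (hball ?_))
      have h1 : dist (Circle.exp θ) (Circle.exp θ₀) = ‖(Circle.exp θ : ℂ) - ζ‖ :=
        dist_eq_norm (Circle.exp θ : ℂ) ζ
      rw [mem_ball, h1, hexp θ]
      exact hlt
  set K : ℝ → ℝ → ℂ := fun r θ =>
    herglotzRieszKernel 0 (r * ζ) (circleMap 0 1 θ) • (V (circleMap 0 1 θ) : ℂ) with hK
  have hKm : ∀ r, Measurable (K r) := fun r => by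
    simp only [hK, herglotzRieszKernel_def]
    have : Measurable fun θ : ℝ => circleMap 0 1 θ := (continuous_circleMap 0 1).measurable
    have hVc : Measurable fun θ => (V (circleMap 0 1 θ) : ℂ) := Complex.measurable_ofReal.comp hV
    fun_prop
  have hbound : ∀ r ∈ Ioc (max 0 (1 - δ / 2)) 1,
      ∀ᵐ θ ∂(volume.restrict (Ioc 0 (2 * Real.pi))), ‖K r θ‖ ≤ 4 / δ * C := by
    intro r hr
    have hr0 : 0 < r := (le_max_left _ _).trans_lt hr.1
    have hrδ : 1 - δ / 2 < r := (le_max_right _ _).trans_lt hr.1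
    filter_upwards [hfar] with θ hθ
    rcases hθ with h | h
    · simp only [hK, h]
      simp
      positivity
    · have h1 : ‖circleMap 0 1 θ + r * ζ‖ ≤ 2 := by
        refine (norm_add_le _ _).trans ?_
        simp only [norm_mul, hζ1, Complex.norm_of_nonneg hr0.le]
        simp
        linarith [hr.2]
      have h2 : δ / 2 ≤ ‖circleMap 0 1 θ - r * ζ‖ := by
        have h3 : circleMap 0 1 θ - ζ = (circleMap 0 1 θ - r * ζ) - (1 - r : ℝ) * ζ := by
          push_cast
          ring
        rw [h3] at h
        have h4 := h.trans (norm_sub_le _ _)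
        rw [norm_mul, hζ1, Complex.norm_of_nonneg (by linarith [hr.2])] at h4
        linarith
      simp only [hK, herglotzRieszKernel_def, sub_zero, smul_eq_mul, norm_mul, norm_div,
        Complex.norm_real]
      calc ‖circleMap 0 1 θ + r * ζ‖ / ‖circleMap 0 1 θ - r * ζ‖ * ‖V (circleMap 0 1 θ)‖
          ≤ 2 / (δ / 2) * C := by
            gcongr
            exact hC θ
        _ = 4 / δ * C := by ring
  have hIoc : ∀ᶠ r : ℝ in 𝓝[<] 1, r ∈ Ioc (max 0 (1 - δ / 2)) 1 := by
    filter_upwards [Ioo_mem_nhdsLT (max_lt zero_lt_one (by linarith : 1 - δ / 2 < 1))] with r hr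
    exact ⟨hr.1, hr.2.le⟩
  have hlim : Tendsto (fun r => ∫ θ in Ioc 0 (2 * Real.pi), K r θ) (𝓝[<] 1)
      (𝓝 (∫ θ in Ioc 0 (2 * Real.pi), K 1 θ)) := by
    refine tendsto_integral_filter_of_dominated_convergence (fun _ => 4 / δ * C)
      (Eventually.of_forall fun r => (hKm r).aestronglyMeasurable)
      (hIoc.mono fun r hr => hbound r hr) (integrable_const _) ?_
    filter_upwards [hfar] with θ hθ
    rcases hθ with h | h
    · simp only [hK, h]
      simp
    · have h1 : circleMap 0 1 θ - ((1 : ℝ) : ℂ) * ζ ≠ 0 := by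
        rw [Complex.ofReal_one, one_mul, ← norm_pos_iff]
        linarith
      have h2 : ContinuousAt (fun r : ℝ => (circleMap 0 1 θ + (r : ℂ) * ζ) /
          (circleMap 0 1 θ - (r : ℂ) * ζ)) 1 :=
        ContinuousAt.div (by fun_prop) (by fun_prop) h1
      have h3 := (h2.tendsto.mono_left nhdsWithin_le_nhds).smul_const
        (V (circleMap 0 1 θ) : ℂ) (l := 𝓝[<] (1 : ℝ))
      simpa only [hK, herglotzRieszKernel_def, sub_zero] using h3
  have hH : ∀ r : ℝ, herglotzIntegral V (r * ζ)
      = ((2 * Real.pi)⁻¹ : ℝ) • ∫ θ in Ioc 0 (2 * Real.pi), K r θ := fun r => by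
    rw [herglotzIntegral, Real.circleAverage_def,
      intervalIntegral.integral_of_le Real.two_pi_pos.le]
  set I : ℂ := ((2 * Real.pi)⁻¹ : ℝ) • ∫ θ in Ioc 0 (2 * Real.pi), K 1 θ with hI
  refine ⟨Complex.exp I, ?_, ?_⟩
  · simp only [outerFunction, hH]
    exact (Complex.continuous_exp.tendsto _).comp (hlim.const_smul _)
  · have hre : (∫ θ in Ioc 0 (2 * Real.pi), K 1 θ).re = 0 := by
      have hint : Integrable (K 1) (volume.restrict (Ioc 0 (2 * Real.pi))) :=
        Integrable.of_bound (hKm 1).aestronglyMeasurable (4 / δ * C)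
          (hbound 1 ⟨max_lt zero_lt_one (by linarith), le_rfl⟩)
      have h1 := Complex.reCLM.integral_comp_comm hint
      simp only [Complex.reCLM_apply] at h1
      rw [← h1]
      refine (integral_congr_ae (Eventually.of_forall fun θ => ?_)).trans (integral_zero _ _)
      simp only [hK, smul_eq_mul, Complex.re_mul_ofReal, Complex.ofReal_one, one_mul]
      rw [re_herglotzRieszKernel_circle hζ1 (by simp), zero_mul]
    rw [Complex.norm_exp, hI, Complex.smul_re, hre]
    simp

/-! ### Replacing a function by one of unit modulus -/

theorem memHardyTwo_iff {f : 𝔻 → ℂ} :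
    MemHardyTwo f ↔ HolomorphicOnDisc f ∧ hardyEnergy (discExt f) < ∞ := by
  refine and_congr_right fun hf => ?_
  rw [iSup_circleAverage_sq hf]

theorem discExt_eqOn_ball (g : ℂ → ℂ) :
    EqOn (discExt fun z : 𝔻 => g z) g (ball 0 1) := by
  intro z hz
  have h := discExt_coe (fun z : 𝔻 => g z) (Complex.UnitDisc.mk z (by simpa using hz))
  simpa using h

theorem taylorCoeff_congr {f g : ℂ → ℂ} (h : EqOn f g (ball 0 1)) (n : ℕ) :
    taylorCoeff f n = taylorCoeff g n := by
  have h1 : f =ᶠ[𝓝 0] g := h.eventuallyEq_of_mem (ball_mem_nhds 0 one_pos)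
  rw [taylorCoeff, taylorCoeff, h1.iteratedDeriv_eq]

theorem hardyEnergy_congr {f g : ℂ → ℂ} (h : EqOn f g (ball 0 1)) :
    hardyEnergy f = hardyEnergy g := by
  simp only [hardyEnergy, taylorCoeff_congr h]

theorem localEnergy_congr {f g : ℂ → ℂ} (h : EqOn f g (ball 0 1)) (w : ℂ) :
    localEnergy w f = localEnergy w g := by
  rw [localEnergy, localEnergy]
  congr 1
  refine setLIntegral_congr_fun measurableSet_ball fun z hz => ?_
  simp only [(h.eventuallyEq_of_mem (isOpen_ball.mem_nhds hz)).deriv_eq]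

/-- A function of the Dirichlet space whose modulus is at least `1` on an open subset of the circle
can be replaced there by a function of unit modulus with a comparable norm. -/
theorem exists_unimodular_on_of_one_le_norm {μ : Measure Circle} [IsFiniteMeasure μ] {f : 𝔻 → ℂ}
    (hf : f ∈ weightedDirichletSpace μ) {U : Set Circle} (hU : IsOpen U)
    (hfU : AEBoundaryValueOn f U fun w => 1 ≤ ‖w‖) {ε : ℝ} (hε : 0 < ε) :
    ∃ g ∈ weightedDirichletSpace μ, AEBoundaryValueOn g U (fun w => ‖w‖ = 1) ∧
      hardyEnergy (discExt g) ≤ hardyEnergy (discExt f) + ENNReal.ofReal (ε ^ 2) ∧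
      dirichletIntegral μ g ≤ 32 * dirichletIntegral μ f := by
  obtain ⟨hfd, hfH⟩ := memHardyTwo_iff.1 hf.1
  obtain ⟨V, C, r, hr, hr1, hV, hC, hlim⟩ := exists_truncated_log hfd hfH hε
  have hH := hardyEnergy_outerFunction_le hfd hε hr hV hC hlim
  have hE : ∀ w : ℂ, ‖w‖ < 1 → localEnergy w (outerFunction V) ≤ 8 * localEnergy w (discExt f) :=
    fun w hw => localEnergy_outerFunction_le hfd hε hr hr1 hV hC hlim hw
  have hVU : ∀ᵐ θ ∂(volume.restrict (Ioc 0 (2 * Real.pi))),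
      Circle.exp θ ∈ U → V (circleMap 0 1 θ) = 0 := by
    filter_upwards [hlim, ae_restrict_of_ae hfU] with θ h1 h2 hθ
    obtain ⟨w, hw, hw1⟩ := h2 hθ
    have h3 : Tendsto (fun n => ‖discExt f (circleMap 0 (r n) θ)‖) atTop (𝓝 ‖w‖) := by
      have := (hw.comp hr1).norm
      simpa [circleMap, Function.comp_def] using this
    have h4 := tendsto_nhds_unique h1 ((((h3.pow 2).add_const (ε ^ 2))).min tendsto_const_nhds)
    have h5 : 1 ≤ ‖w‖ ^ 2 + ε ^ 2 := by nlinarith [sq_nonneg ε]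
    rw [min_eq_right h5, Real.exp_eq_one_iff] at h4
    linarith
  have heq := discExt_eqOn_ball (outerFunction V)
  have hD : dirichletIntegral μ (fun z : 𝔻 => outerFunction V z) ≤ 32 * dirichletIntegral μ f := by
    rw [dirichletIntegral_eq_lintegral_localEnergy, dirichletIntegral_eq_lintegral_localEnergy,
      ← lintegral_const_mul' _ _ (by simp)]
    refine lintegral_mono fun ζ => ?_
    rw [localEnergy_congr heq]
    refine (localEnergy_boundary_le hE (Circle.norm_coe ζ)).trans (le_of_eq ?_)
    rw [← mul_assoc]
    norm_num
  have hd : HolomorphicOnDisc fun z : 𝔻 => outerFunction V z :=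
    (differentiableOn_outerFunction (circleIntegrable_of_bounded hV hC)).congr heq
  rw [← hardyEnergy_congr heq] at hH
  refine ⟨fun z : 𝔻 => outerFunction V z, ⟨memHardyTwo_iff.2 ⟨hd, hH.trans_lt ?_⟩,
    hD.trans_lt ?_⟩, ?_, hH, hD⟩
  · exact ENNReal.add_lt_top.2 ⟨hfH, ENNReal.ofReal_lt_top⟩
  · exact ENNReal.mul_lt_top (by simp) hf.2
  · refine Eventually.of_forall fun θ hθ => ?_
    obtain ⟨w, hw, hw1⟩ := exists_tendsto_outerFunction_norm_eq_one hV hC hU hVU hθ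
    refine ⟨w, hw.congr' ?_, hw1⟩
    filter_upwards [Ioo_mem_nhdsLT (zero_lt_one : (0 : ℝ) < 1)] with r hr
    exact (heq (by simpa [abs_of_pos hr.1] using hr.2)).symm

/-! ### The Dirichlet space as a space of pairs -/

/-- The power series with square summable coefficients `a`. -/
noncomputable def powerSeriesSum (a : lp (fun _ : ℕ => ℂ) 2) (z : ℂ) : ℂ := ∑' n, a n * z ^ n

theorem summable_lp_mul_pow (a : lp (fun _ : ℕ => ℂ) 2) {z : ℂ} (hz : ‖z‖ < 1) :
    Summable fun n => ‖a n * z ^ n‖ := by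
  refine ((summable_geometric_of_lt_one (norm_nonneg z) hz).mul_left ‖a‖).of_nonneg_of_le
    (fun n => norm_nonneg _) fun n => ?_
  rw [norm_mul, norm_pow]
  gcongr
  exact lp.norm_apply_le_norm two_ne_zero a n

theorem norm_powerSeriesSum_le (a : lp (fun _ : ℕ => ℂ) 2) {z : ℂ} (hz : ‖z‖ < 1) :
    ‖powerSeriesSum a z‖ ≤ ‖a‖ * (1 - ‖z‖)⁻¹ := by
  refine (norm_tsum_le_tsum_norm (summable_lp_mul_pow a hz)).trans ?_
  rw [← tsum_geometric_of_lt_one (norm_nonneg z) hz, ← tsum_mul_left]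
  refine (summable_lp_mul_pow a hz).tsum_le_tsum (fun n => ?_)
    ((summable_geometric_of_lt_one (norm_nonneg z) hz).mul_left ‖a‖)
  rw [norm_mul, norm_pow]
  gcongr
  exact lp.norm_apply_le_norm two_ne_zero a n

theorem powerSeriesSum_sub (a b : lp (fun _ : ℕ => ℂ) 2) {z : ℂ} (hz : ‖z‖ < 1) :
    powerSeriesSum (a - b) z = powerSeriesSum a z - powerSeriesSum b z := by
  rw [powerSeriesSum, powerSeriesSum, powerSeriesSum,
    ← (summable_lp_mul_pow a hz).of_norm.tsum_sub (summable_lp_mul_pow b hz).of_norm]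
  congr 1
  ext n
  simp [sub_mul]

theorem differentiableOn_powerSeriesSum (a : lp (fun _ : ℕ => ℂ) 2) :
    DifferentiableOn ℂ (powerSeriesSum a) (ball 0 1) := by
  intro z hz
  have hz1 : ‖z‖ < 1 := by simpa using hz
  obtain ⟨ρ, hzρ, hρ1⟩ := exists_between hz1
  have hρ0 : 0 ≤ ρ := (norm_nonneg z).trans hzρ.le
  have h1 : DifferentiableOn ℂ (powerSeriesSum a) (ball 0 ρ) := by
    refine Complex.differentiableOn_tsum_of_summable_norm
      ((summable_geometric_of_lt_one hρ0 hρ1).mul_left ‖a‖) (fun n => by fun_prop) isOpen_ball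
      fun n u hu => ?_
    have hu1 : ‖u‖ ≤ ρ := by simpa using (mem_ball_zero_iff.1 hu).le
    rw [norm_mul, norm_pow]
    gcongr
    exact lp.norm_apply_le_norm two_ne_zero a n
  exact (h1.differentiableAt (isOpen_ball.mem_nhds (by simpa using hzρ))).differentiableWithinAt

/-- Taylor coefficients are unique, by Parseval's identity. -/
theorem taylorCoeff_eq_of_hasSum {f : ℂ → ℂ} (hf : DifferentiableOn ℂ f (ball 0 1)) {a : ℕ → ℂ}
    (ha : ∀ z ∈ ball (0 : ℂ) 1, HasSum (fun n => a n * z ^ n) (f z)) (n : ℕ) :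
    taylorCoeff f n = a n := by
  have hhalf : ‖(1 / 2 : ℂ)‖ = 1 / 2 := by norm_num
  have hmem : ∀ z ∈ sphere (0 : ℂ) 1, (1 / 2 : ℂ) * z ∈ ball (0 : ℂ) 1 := by
    intro z hz
    have hz1 : ‖z‖ = 1 := by simpa using hz
    rw [mem_ball_zero_iff, norm_mul, hhalf, hz1]
    norm_num
  have hs1 := (hasSum_taylorCoeff hf (z := 1 / 2) (by rw [mem_ball_zero_iff, hhalf]; norm_num)).sub
    (ha (1 / 2) (by rw [mem_ball_zero_iff, hhalf]; norm_num))
  have h := hasSum_sq_circleAverage (b := fun n => (taylorCoeff f n - a n) * (1 / 2 : ℂ) ^ n)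
    (F := fun _ => 0) ?_ fun z hz => ?_
  · have h0 : Real.circleAverage (fun _ : ℂ => ‖(0 : ℂ)‖ ^ 2) 0 1 = 0 := by
      rw [Real.circleAverage_const]
      simp
    rw [h0, hasSum_zero_iff_of_nonneg fun n => by positivity] at h
    have h2 := congrFun h n
    simp only [Pi.zero_apply, pow_eq_zero_iff two_ne_zero, norm_eq_zero, mul_eq_zero] at h2
    rcases h2 with h2 | h2
    · exact sub_eq_zero.1 h2
    · exact absurd h2 (pow_ne_zero _ (by norm_num))
  · refine Summable.norm (hs1.summable.congr fun n => ?_)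
    ring
  · have h3 := (hasSum_taylorCoeff hf (hmem z hz)).sub (ha _ (hmem z hz))
    rw [sub_self] at h3
    refine h3.congr_fun fun n => ?_
    rw [mul_pow]
    ring

theorem taylorCoeff_powerSeriesSum (a : lp (fun _ : ℕ => ℂ) 2) (n : ℕ) :
    taylorCoeff (powerSeriesSum a) n = a n :=
  taylorCoeff_eq_of_hasSum (differentiableOn_powerSeriesSum a) (fun z hz =>
    (summable_lp_mul_pow a (by simpa using hz)).of_norm.hasSum) n

theorem powerSeriesSum_eq {f : ℂ → ℂ} (hf : DifferentiableOn ℂ f (ball 0 1))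
    {a : lp (fun _ : ℕ => ℂ) 2} (ha : ∀ n, a n = taylorCoeff f n) {z : ℂ}
    (hz : z ∈ ball (0 : ℂ) 1) : powerSeriesSum a z = f z := by
  simp only [powerSeriesSum, ha]
  exact (hasSum_taylorCoeff hf hz).tsum_eq

theorem tendstoLocallyUniformlyOn_powerSeriesSum {a : ℕ → lp (fun _ : ℕ => ℂ) 2}
    {a' : lp (fun _ : ℕ => ℂ) 2} (h : Tendsto a atTop (𝓝 a')) :
    TendstoLocallyUniformlyOn (fun k => powerSeriesSum (a k)) (powerSeriesSum a') atTop
      (ball 0 1) := by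
  rw [tendstoLocallyUniformlyOn_iff_forall_isCompact isOpen_ball]
  intro K hK hKc
  obtain ⟨ρ, hρ1, hρ⟩ : ∃ ρ < 1, ∀ z ∈ K, ‖z‖ ≤ ρ := by
    rcases K.eq_empty_or_nonempty with rfl | hne
    · exact ⟨0, one_pos, by simp⟩
    · obtain ⟨z₀, hz₀, hmax⟩ := hKc.exists_isMaxOn hne continuous_norm.continuousOn
      exact ⟨‖z₀‖, by simpa using hK hz₀, fun z hz => hmax hz⟩
  rw [Metric.tendstoUniformlyOn_iff]
  intro ε hε
  have h1 : Tendsto (fun k => ‖a' - a k‖ * (1 - ρ)⁻¹) atTop (𝓝 0) := by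
    have := ((tendsto_const_nhds (x := a')).sub h).norm.mul_const (1 - ρ)⁻¹
    simpa using this
  filter_upwards [h1.eventually_lt_const hε] with k hk z hz
  have hz1 : ‖z‖ < 1 := by simpa using hK hz
  rw [dist_eq_norm, ← powerSeriesSum_sub _ _ hz1]
  refine lt_of_le_of_lt ((norm_powerSeriesSum_le _ hz1).trans ?_) hk
  have := hρ z hz
  gcongr

theorem tendsto_deriv_powerSeriesSum {a : ℕ → lp (fun _ : ℕ => ℂ) 2}
    {a' : lp (fun _ : ℕ => ℂ) 2} (h : Tendsto a atTop (𝓝 a')) {z : ℂ} (hz : z ∈ ball (0 : ℂ) 1) :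
    Tendsto (fun k => deriv (powerSeriesSum (a k)) z) atTop (𝓝 (deriv (powerSeriesSum a') z)) :=
  ((tendstoLocallyUniformlyOn_powerSeriesSum h).deriv
    (Eventually.of_forall fun k => differentiableOn_powerSeriesSum (a k)) isOpen_ball).tendsto_at hz

/-- The weight `P_μ dA` on the disc. -/
noncomputable def dirichletMeasure (μ : Measure Circle) : Measure ℂ :=
  (volume.restrict (ball (0 : ℂ) 1)).withDensity (poissonIntegral μ)

theorem measurable_poissonIntegral (μ : Measure Circle) [IsFiniteMeasure μ] :
    Measurable (poissonIntegral μ) := by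
  have hcoe : Measurable fun ζ : Circle => (ζ : ℂ) := Continuous.measurable (by fun_prop)
  have h : Measurable fun p : ℂ × Circle =>
      ENNReal.ofReal ((1 - ‖p.1‖ ^ 2) / ‖p.1 - (p.2 : ℂ)‖ ^ 2) :=
    (((measurable_fst.norm.pow_const 2).const_sub 1).div
      ((measurable_fst.sub (hcoe.comp measurable_snd)).norm.pow_const 2)).ennreal_ofReal
  exact h.lintegral_prod_right'

theorem lintegral_dirichletMeasure (μ : Measure Circle) [IsFiniteMeasure μ] (f : 𝔻 → ℂ) :
    ∫⁻ z, ‖deriv (discExt f) z‖ₑ ^ 2 ∂(dirichletMeasure μ)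
      = ENNReal.ofReal Real.pi * dirichletIntegral μ f := by
  have := measurable_deriv (discExt f)
  rw [dirichletMeasure, lintegral_withDensity_eq_lintegral_mul _ (measurable_poissonIntegral μ)
    (by fun_prop), dirichletIntegral, ← mul_assoc, ← ENNReal.ofReal_mul Real.pi_pos.le,
    mul_one_div_cancel Real.pi_pos.ne', ENNReal.ofReal_one, one_mul]
  congr 1
  ext z
  exact mul_comm _ _

theorem ae_dirichletMeasure_mem_ball (μ : Measure Circle) :
    ∀ᵐ z ∂(dirichletMeasure μ), z ∈ ball (0 : ℂ) 1 :=
  (withDensity_absolutelyContinuous _ _).ae_le (ae_restrict_mem measurableSet_ball)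

theorem enorm_sq_eq_hardyEnergy {a : lp (fun _ : ℕ => ℂ) 2} {f : ℂ → ℂ}
    (ha : ∀ n, a n = taylorCoeff f n) : ‖a‖ₑ ^ 2 = hardyEnergy f := by
  have h := lp.hasSum_norm (p := 2) (by norm_num) a
  simp only [ENNReal.toReal_ofNat, Real.rpow_ofNat] at h
  rw [← ofReal_norm, ← ENNReal.ofReal_pow (norm_nonneg _), ← h.tsum_eq,
    ENNReal.ofReal_tsum_of_nonneg (fun n => by positivity) h.summable, hardyEnergy]
  congr 1
  ext n
  rw [ENNReal.ofReal_pow (norm_nonneg _), ofReal_norm, ha]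

theorem memℓp_taylorCoeff {f : ℂ → ℂ} (h : hardyEnergy f < ∞) : Memℓp (taylorCoeff f) 2 := by
  refine memℓp_gen ?_
  simpa using summable_sq_of_hardyEnergy_lt_top h

theorem eLpNorm_two_sq {α : Type*} [MeasurableSpace α] {ν : Measure α} (F : α → ℂ) :
    eLpNorm F 2 ν ^ 2 = ∫⁻ x, ‖F x‖ₑ ^ 2 ∂ν := by
  simpa using eLpNorm_nnreal_pow_eq_lintegral (p := 2) (f := F) (μ := ν) two_ne_zero

theorem memLp_deriv_of_mem {μ : Measure Circle} [IsFiniteMeasure μ] {f : 𝔻 → ℂ}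
    (hf : dirichletIntegral μ f < ∞) : MemLp (deriv (discExt f)) 2 (dirichletMeasure μ) := by
  refine ⟨(measurable_deriv _).aestronglyMeasurable, ?_⟩
  have h : eLpNorm (deriv (discExt f)) 2 (dirichletMeasure μ) ^ 2 < ∞ := by
    rw [eLpNorm_two_sq, lintegral_dirichletMeasure]
    exact ENNReal.mul_lt_top ENNReal.ofReal_lt_top hf
  exact lt_top_iff_ne_top.2 fun htop => by simp [htop] at h

/-- If coefficients converge in `ℓ²` and derivatives converge in `L²`, the limits belong to the
same holomorphic function. -/
theorem deriv_powerSeriesSum_ae_eq {μ : Measure Circle}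
    {a : ℕ → lp (fun _ : ℕ => ℂ) 2} {a' : lp (fun _ : ℕ => ℂ) 2} (ha : Tendsto a atTop (𝓝 a'))
    {G : ℕ → Lp ℂ 2 (dirichletMeasure μ)} {G' : Lp ℂ 2 (dirichletMeasure μ)}
    (hG : Tendsto G atTop (𝓝 G'))
    (haG : ∀ k, G k =ᵐ[dirichletMeasure μ] deriv (powerSeriesSum (a k))) :
    G' =ᵐ[dirichletMeasure μ] deriv (powerSeriesSum a') := by
  obtain ⟨ns, hns, hlim⟩ := (tendstoInMeasure_of_tendsto_Lp hG).exists_seq_tendsto_ae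
  filter_upwards [hlim, ae_all_iff.2 haG, ae_dirichletMeasure_mem_ball μ] with z h1 h2 h3
  refine tendsto_nhds_unique h1 ?_
  simp only [h2]
  exact (tendsto_deriv_powerSeriesSum ha h3).comp hns.tendsto_atTop

theorem discExt_add (f g : 𝔻 → ℂ) : discExt (f + g) = discExt f + discExt g := by
  ext z
  by_cases hz : ∃ u : 𝔻, (u : ℂ) = z
  · obtain ⟨u, rfl⟩ := hz
    simp [discExt_coe]
  · simp [discExt, Function.extend_apply' _ _ _ hz]

theorem discExt_smul (c : ℂ) (f : 𝔻 → ℂ) : discExt (c • f) = c • discExt f := by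
  ext z
  by_cases hz : ∃ u : 𝔻, (u : ℂ) = z
  · obtain ⟨u, rfl⟩ := hz
    simp [discExt_coe]
  · simp [discExt, Function.extend_apply' _ _ _ hz]

theorem taylorCoeff_add {f g : ℂ → ℂ} (hf : DifferentiableOn ℂ f (ball 0 1))
    (hg : DifferentiableOn ℂ g (ball 0 1)) (n : ℕ) :
    taylorCoeff (f + g) n = taylorCoeff f n + taylorCoeff g n := by
  refine taylorCoeff_eq_of_hasSum (a := fun n => taylorCoeff f n + taylorCoeff g n)
    (hf.add hg) (fun z hz => ?_) n
  refine ((hasSum_taylorCoeff hf hz).add (hasSum_taylorCoeff hg hz)).congr_fun fun n => ?_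
  exact add_mul _ _ _

theorem taylorCoeff_smul (c : ℂ) {f : ℂ → ℂ} (hf : DifferentiableOn ℂ f (ball 0 1)) (n : ℕ) :
    taylorCoeff (c • f) n = c * taylorCoeff f n := by
  refine taylorCoeff_eq_of_hasSum (a := fun n => c * taylorCoeff f n)
    (hf.const_smul c) (fun z hz => ?_) n
  refine ((hasSum_taylorCoeff hf hz).mul_left c).congr_fun fun n => ?_
  exact mul_assoc _ _ _

theorem deriv_add_ae_eq {μ : Measure Circle} {f g : ℂ → ℂ}
    (hf : DifferentiableOn ℂ f (ball 0 1)) (hg : DifferentiableOn ℂ g (ball 0 1)) :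
    deriv (f + g) =ᵐ[dirichletMeasure μ] deriv f + deriv g := by
  filter_upwards [ae_dirichletMeasure_mem_ball μ] with z hz
  exact deriv_add (hf.differentiableAt (isOpen_ball.mem_nhds hz))
    (hg.differentiableAt (isOpen_ball.mem_nhds hz))

theorem deriv_smul_ae_eq {μ : Measure Circle} (c : ℂ) {f : ℂ → ℂ}
    (hf : DifferentiableOn ℂ f (ball 0 1)) :
    deriv (c • f) =ᵐ[dirichletMeasure μ] c • deriv f := by
  filter_upwards [ae_dirichletMeasure_mem_ball μ] with z hz
  exact deriv_const_smul c (hf.differentiableAt (isOpen_ball.mem_nhds hz))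

section
variable {b : HInftyBall} {μ : Measure Circle} [IsFiniteMeasure μ]

/-- The linear map sending `f ∈ H(b)`, when `H(b) ⊆ D_μ`, to its Taylor coefficients and its
derivative. The norm of the pair is equivalent to the norm of `f` in `D_μ`. -/
noncomputable def coeffDerivMap
    (h : ∀ f : DeBrangesRovnyakSpace b, (f : 𝔻 → ℂ) ∈ weightedDirichletSpace μ) :
    DeBrangesRovnyakSpace b →ₗ[ℂ] lp (fun _ : ℕ => ℂ) 2 × Lp ℂ 2 (dirichletMeasure μ) where
  toFun f := (⟨taylorCoeff (discExt f), memℓp_taylorCoeff (memHardyTwo_iff.1 (h f).1).2⟩,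
    (memLp_deriv_of_mem (h f).2).toLp)
  map_add' f g := by
    have hf := (memHardyTwo_iff.1 (h f).1).1
    have hg := (memHardyTwo_iff.1 (h g).1).1
    refine Prod.ext ?_ ?_
    · ext n
      simp only [RKHS.coe_add, discExt_add]
      exact taylorCoeff_add hf hg n
    · simp only [Prod.snd_add]
      rw [← MemLp.toLp_add]
      refine MemLp.toLp_congr _ _ ?_
      rw [RKHS.coe_add, discExt_add]
      exact deriv_add_ae_eq hf hg
  map_smul' c f := by
    have hf := (memHardyTwo_iff.1 (h f).1).1
    refine Prod.ext ?_ ?_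
    · ext n
      simp only [RKHS.coe_smul, discExt_smul]
      exact taylorCoeff_smul c hf n
    · simp only [Prod.smul_snd, RingHom.id_apply]
      rw [← MemLp.toLp_const_smul]
      refine MemLp.toLp_congr _ _ ?_
      rw [RKHS.coe_smul, discExt_smul]
      exact deriv_smul_ae_eq c hf

variable (h : ∀ f : DeBrangesRovnyakSpace b, (f : 𝔻 → ℂ) ∈ weightedDirichletSpace μ)

theorem coeffDerivMap_fst_apply (f : DeBrangesRovnyakSpace b) (n : ℕ) :
    (coeffDerivMap h f).1 n = taylorCoeff (discExt f) n := rfl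

theorem powerSeriesSum_coeffDerivMap (f : DeBrangesRovnyakSpace b) :
    EqOn (powerSeriesSum (coeffDerivMap h f).1) (discExt f) (ball 0 1) := fun _ hz =>
  powerSeriesSum_eq (memHardyTwo_iff.1 (h f).1).1 (fun _ => rfl) hz

theorem coeffDerivMap_snd_ae_eq (f : DeBrangesRovnyakSpace b) :
    (coeffDerivMap h f).2 =ᵐ[dirichletMeasure μ] deriv (powerSeriesSum (coeffDerivMap h f).1) := by
  have h1 : (coeffDerivMap h f).2 =ᵐ[dirichletMeasure μ] deriv (discExt f) :=
    MemLp.coeFn_toLp (memLp_deriv_of_mem (h f).2)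
  filter_upwards [h1, ae_dirichletMeasure_mem_ball μ] with z hz hz1
  rw [hz]
  exact ((powerSeriesSum_coeffDerivMap h f).eventuallyEq_of_mem
    (isOpen_ball.mem_nhds hz1)).deriv_eq.symm

theorem enorm_coeffDerivMap_fst_sq (f : DeBrangesRovnyakSpace b) :
    ‖(coeffDerivMap h f).1‖ₑ ^ 2 = hardyEnergy (discExt f) :=
  enorm_sq_eq_hardyEnergy fun _ => rfl

theorem enorm_coeffDerivMap_snd_sq (f : DeBrangesRovnyakSpace b) :
    ‖(coeffDerivMap h f).2‖ₑ ^ 2 = ENNReal.ofReal Real.pi * dirichletIntegral μ f := by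
  have : ‖(coeffDerivMap h f).2‖ₑ = eLpNorm (deriv (discExt f)) 2 (dirichletMeasure μ) :=
    Lp.enorm_toLp (memLp_deriv_of_mem (h f).2)
  rw [this, eLpNorm_two_sq, lintegral_dirichletMeasure]

theorem coeffDerivMap_eq_of_tendsto {f : ℕ → DeBrangesRovnyakSpace b} {f' : DeBrangesRovnyakSpace b}
    {y : lp (fun _ : ℕ => ℂ) 2 × Lp ℂ 2 (dirichletMeasure μ)}
    (hy : Tendsto (fun k => coeffDerivMap h (f k)) atTop (𝓝 y))
    (hf' : EqOn (powerSeriesSum y.1) (discExt f') (ball 0 1)) : y = coeffDerivMap h f' := by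
  have h1 : y.1 = (coeffDerivMap h f').1 := by
    ext n
    rw [coeffDerivMap_fst_apply, ← taylorCoeff_congr hf' n, taylorCoeff_powerSeriesSum]
  refine Prod.ext h1 (Lp.ext ?_)
  refine (deriv_powerSeriesSum_ae_eq ((continuous_fst.tendsto _).comp hy)
    ((continuous_snd.tendsto _).comp hy) fun k => coeffDerivMap_snd_ae_eq h (f k)).trans ?_
  rw [h1]
  exact (coeffDerivMap_snd_ae_eq h f').symm

/-- The map to coefficients and derivative is bounded, by the closed graph theorem. -/
noncomputable def coeffDerivCLM :
    DeBrangesRovnyakSpace b →L[ℂ] lp (fun _ : ℕ => ℂ) 2 × Lp ℂ 2 (dirichletMeasure μ) :=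
  ContinuousLinearMap.ofSeqClosedGraph (g := coeffDerivMap h) fun f f' y hf hy => by
    refine coeffDerivMap_eq_of_tendsto h hy fun z hz => ?_
    have h1 := ((tendstoLocallyUniformlyOn_powerSeriesSum
      ((continuous_fst.tendsto _).comp hy)).tendsto_at hz)
    refine tendsto_nhds_unique h1 ?_
    have h2 : ∀ k, powerSeriesSum ((Prod.fst ∘ ⇑(coeffDerivMap h) ∘ f) k) z = discExt (f k) z :=
      fun k => powerSeriesSum_coeffDerivMap h (f k) hz
    simp only [h2]
    have h3 : ∀ g : DeBrangesRovnyakSpace b,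
        discExt g z = g (Complex.UnitDisc.mk z (by simpa using hz)) := fun g =>
      discExt_coe g (Complex.UnitDisc.mk z (by simpa using hz))
    simp only [h3]
    exact ((RKHS.continuous_eval (𝕜 := ℂ) (H := DeBrangesRovnyakSpace b) _).tendsto f').comp hf

theorem coeffDerivCLM_apply (f : DeBrangesRovnyakSpace b) :
    coeffDerivCLM h f = coeffDerivMap h f := rfl

theorem injective_coeffDerivCLM : Function.Injective (coeffDerivCLM h) := by
  intro f g hfg
  simp only [coeffDerivCLM_apply] at hfg
  refine DFunLike.ext _ _ fun z => ?_
  have hz : (z : ℂ) ∈ ball (0 : ℂ) 1 := by simpa using z.norm_lt_one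
  rw [← discExt_coe f, ← discExt_coe g, ← powerSeriesSum_coeffDerivMap h f hz,
    ← powerSeriesSum_coeffDerivMap h g hz, hfg]

/-- A limit of pairs again consists of the coefficients and the derivative of a single function,
which belongs to `D_μ` and therefore to `H(b)`. -/
theorem isClosed_range_coeffDerivCLM
    (h' : ∀ g ∈ weightedDirichletSpace μ, ∃ f : DeBrangesRovnyakSpace b, (f : 𝔻 → ℂ) = g) :
    IsClosed (range (coeffDerivCLM h)) := by
  refine IsSeqClosed.isClosed fun x y hx hy => ?_
  choose f hf using hx
  obtain rfl : (fun k => coeffDerivMap h (f k)) = x := funext hf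
  have hext := discExt_eqOn_ball (powerSeriesSum y.1)
  have hdiff := (differentiableOn_powerSeriesSum y.1).congr hext
  have hmem : (fun z : 𝔻 => powerSeriesSum y.1 z) ∈ weightedDirichletSpace μ := by
    refine ⟨memHardyTwo_iff.2 ⟨hdiff, ?_⟩, ?_⟩
    · rw [hardyEnergy_congr hext, ← enorm_sq_eq_hardyEnergy (a := y.1)
        fun n => (taylorCoeff_powerSeriesSum y.1 n).symm]
      exact ENNReal.pow_lt_top enorm_lt_top
    · have h1 : y.2 =ᵐ[dirichletMeasure μ]
          deriv (discExt fun z : 𝔻 => powerSeriesSum y.1 z) := by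
        have h2 := deriv_powerSeriesSum_ae_eq ((continuous_fst.tendsto _).comp hy)
          ((continuous_snd.tendsto _).comp hy) fun k => coeffDerivMap_snd_ae_eq h (f k)
        filter_upwards [h2, ae_dirichletMeasure_mem_ball μ] with z hz hz1
        rw [hz]
        exact (hext.eventuallyEq_of_mem (isOpen_ball.mem_nhds hz1)).deriv_eq.symm
      have h3 : ENNReal.ofReal Real.pi *
          dirichletIntegral μ (fun z : 𝔻 => powerSeriesSum y.1 z) < ∞ := by
        rw [← lintegral_dirichletMeasure, ← eLpNorm_two_sq, ← eLpNorm_congr_ae h1]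
        exact ENNReal.pow_lt_top (Lp.memLp y.2).2
      refine lt_top_iff_ne_top.2 fun htop => h3.ne ?_
      rw [htop, ENNReal.mul_top (by simpa using Real.pi_pos)]
  obtain ⟨f', hf'⟩ := h' _ hmem
  refine ⟨f', (coeffDerivMap_eq_of_tendsto h hy ?_).symm⟩
  rw [hf']
  exact hext.symm

end

/-- If `H(b) = D_μ` as sets, their norms are equivalent. -/
theorem exists_norm_equivalence {b : HInftyBall} {μ : Measure Circle} [IsFiniteMeasure μ]
    (hμ : deBrangesRovnyakFunctions b = weightedDirichletSpace μ) :
    ∃ c : ℝ≥0, ∀ f : DeBrangesRovnyakSpace b,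
      hardyEnergy (discExt f) + dirichletIntegral μ f ≤ c * ‖f‖ₑ ^ 2 ∧
      ‖f‖ₑ ^ 2 ≤ c * (hardyEnergy (discExt f) + dirichletIntegral μ f) := by
  have h : ∀ f : DeBrangesRovnyakSpace b, (f : 𝔻 → ℂ) ∈ weightedDirichletSpace μ :=
    fun f => hμ ▸ mem_range_self f
  obtain ⟨K, hK⟩ := (coeffDerivCLM h).antilipschitz_of_injective_of_isClosed_range
    (injective_coeffDerivCLM h) (isClosed_range_coeffDerivCLM h fun g hg => by
      rw [← hμ] at hg
      exact hg)
  have hpi1 : (1 : ℝ≥0∞) ≤ ENNReal.ofReal Real.pi := by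
    rw [ENNReal.one_le_ofReal]
    linarith [Real.pi_gt_three]
  have hpi4 : ENNReal.ofReal Real.pi ≤ 4 := by
    rw [ENNReal.ofReal_le_iff_le_toReal (by simp)]
    simpa using Real.pi_le_four
  refine ⟨2 * ‖coeffDerivCLM h‖₊ ^ 2 + 4 * K ^ 2, fun f => ⟨?_, ?_⟩⟩
  · have hT : ‖coeffDerivMap h f‖ₑ ≤ ‖coeffDerivCLM h‖₊ * ‖f‖ₑ :=
      (coeffDerivCLM h).le_opENorm f
    have h1 : ‖(coeffDerivMap h f).1‖ₑ ≤ ‖coeffDerivMap h f‖ₑ :=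
      enorm_le_iff_norm_le.2 (norm_fst_le _)
    have h2 : ‖(coeffDerivMap h f).2‖ₑ ≤ ‖coeffDerivMap h f‖ₑ :=
      enorm_le_iff_norm_le.2 (norm_snd_le _)
    calc hardyEnergy (discExt f) + dirichletIntegral μ f
        ≤ ‖(coeffDerivMap h f).1‖ₑ ^ 2 + ‖(coeffDerivMap h f).2‖ₑ ^ 2 := by
          rw [enorm_coeffDerivMap_fst_sq, enorm_coeffDerivMap_snd_sq]
          gcongr
          exact le_mul_of_one_le_left' hpi1
      _ ≤ (‖coeffDerivCLM h‖₊ * ‖f‖ₑ) ^ 2 + (‖coeffDerivCLM h‖₊ * ‖f‖ₑ) ^ 2 := by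
          gcongr
          exacts [h1.trans hT, h2.trans hT]
      _ = (2 * ‖coeffDerivCLM h‖₊ ^ 2 + 0) * ‖f‖ₑ ^ 2 := by ring
      _ ≤ _ := by
          push_cast
          gcongr
          exact zero_le
  · have hT : ‖f‖ₑ ≤ K * ‖coeffDerivMap h f‖ₑ := by
      have := hK f 0
      rwa [map_zero, edist_zero_right, edist_zero_right] at this
    have h1 : ‖coeffDerivMap h f‖ₑ ^ 2
        ≤ ‖(coeffDerivMap h f).1‖ₑ ^ 2 + ‖(coeffDerivMap h f).2‖ₑ ^ 2 := by
      rcases le_total ‖(coeffDerivMap h f).1‖ ‖(coeffDerivMap h f).2‖ with hle | hle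
      · have : ‖coeffDerivMap h f‖ₑ ≤ ‖(coeffDerivMap h f).2‖ₑ :=
          enorm_le_iff_norm_le.2 (by rw [Prod.norm_def, max_eq_right hle])
        exact (pow_le_pow_left' this 2).trans le_add_self
      · have : ‖coeffDerivMap h f‖ₑ ≤ ‖(coeffDerivMap h f).1‖ₑ :=
          enorm_le_iff_norm_le.2 (by rw [Prod.norm_def, max_eq_left hle])
        exact (pow_le_pow_left' this 2).trans le_self_add
    calc ‖f‖ₑ ^ 2 ≤ (K * ‖coeffDerivMap h f‖ₑ) ^ 2 := by gcongr
      _ ≤ K ^ 2 * (‖(coeffDerivMap h f).1‖ₑ ^ 2 + ‖(coeffDerivMap h f).2‖ₑ ^ 2) := by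
          rw [mul_pow]
          gcongr
      _ ≤ K ^ 2 * (4 * hardyEnergy (discExt f) + 4 * dirichletIntegral μ f) := by
          rw [enorm_coeffDerivMap_fst_sq, enorm_coeffDerivMap_snd_sq]
          gcongr
          exact le_mul_of_one_le_left' (by norm_num)
      _ = (0 + 4 * K ^ 2) * (hardyEnergy (discExt f) + dirichletIntegral μ f) := by ring
      _ ≤ _ := by
          push_cast
          gcongr
          exact zero_le

/-! ### Comparison of the two capacities -/

theorem proposition9p2 (b : HInftyBall) (hb : b.norm = 1)
    (μ : Measure Circle) [IsFiniteMeasure μ]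
    (hμ : deBrangesRovnyakFunctions b = weightedDirichletSpace μ) :
    ∃ A : ℝ≥0, 0 < A ∧ ∀ E : Set Circle, capacityTwo b E ≤ A * capacityOne b E := by
  obtain ⟨c, hc⟩ := exists_norm_equivalence hμ
  -- The summand `1` only ensures that the constant is nonzero.
  refine ⟨32 * c ^ 2 + 1, by positivity, fun E => ?_⟩
  have hA : ((32 * c ^ 2 + 1 : ℝ≥0) : ℝ≥0∞) ≠ 0 :=
    ENNReal.coe_ne_zero.2 (by positivity : (0 : ℝ≥0) < 32 * c ^ 2 + 1).ne'
  simp only [capacityOne, ENNReal.mul_iInf_of_ne hA ENNReal.coe_ne_top]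
  refine le_iInf₂ fun f ⟨U, hU, hEU, hfU⟩ => ?_
  -- The energy of the competitor exceeds its bound by a multiple of `ε ^ 2`, so let `ε → 0`.
  have hlim : Tendsto (fun ε : ℝ => 32 * c ^ 2 * ‖f‖ₑ ^ 2 + c * ENNReal.ofReal (ε ^ 2)) (𝓝[>] 0)
      (𝓝 (32 * c ^ 2 * ‖f‖ₑ ^ 2 + c * ENNReal.ofReal (0 ^ 2))) := by
    refine Tendsto.const_add _ (ENNReal.Tendsto.const_mul ?_ (Or.inr ENNReal.coe_ne_top))
    refine (ENNReal.continuous_ofReal.tendsto _).comp ?_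
    exact ((continuous_pow 2).tendsto (0 : ℝ)).mono_left nhdsWithin_le_nhds
  have hle : capacityTwo b E ≤ 32 * c ^ 2 * ‖f‖ₑ ^ 2 + c * ENNReal.ofReal (0 ^ 2) := by
    refine ge_of_tendsto hlim (eventually_nhdsWithin_of_forall fun ε hε => ?_)
    have hf : (f : 𝔻 → ℂ) ∈ weightedDirichletSpace μ := hμ ▸ mem_range_self f
    obtain ⟨g, hg, hgU, hgH, hgD⟩ := exists_unimodular_on_of_one_le_norm hf hU hfU hε
    rw [← hμ] at hg
    obtain ⟨g', rfl⟩ := hg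
    calc capacityTwo b E ≤ ‖g'‖ₑ ^ 2 := iInf₂_le g' ⟨U, hU, hEU, hgU⟩
      _ ≤ c * (hardyEnergy (discExt g') + dirichletIntegral μ g') := (hc g').2
      _ ≤ c * (hardyEnergy (discExt f) + ENNReal.ofReal (ε ^ 2) + 32 * dirichletIntegral μ f) := by
          gcongr
      _ ≤ c * (32 * hardyEnergy (discExt f) + ENNReal.ofReal (ε ^ 2)
            + 32 * dirichletIntegral μ f) := by
          gcongr
          exact le_mul_of_one_le_left' (by norm_num)
      _ = 32 * c * (hardyEnergy (discExt f) + dirichletIntegral μ f)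
            + c * ENNReal.ofReal (ε ^ 2) := by ring
      _ ≤ 32 * c * (c * ‖f‖ₑ ^ 2) + c * ENNReal.ofReal (ε ^ 2) := by
          gcongr
          exact (hc f).1
      _ = 32 * c ^ 2 * ‖f‖ₑ ^ 2 + c * ENNReal.ofReal (ε ^ 2) := by ring
  refine hle.trans ?_
  rw [zero_pow two_ne_zero, ENNReal.ofReal_zero, mul_zero, add_zero]
  push_cast
  gcongr
  exact le_self_add
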